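/- For $t_z>0$ let $\varepsilon(\mathbf k)=-2(\cos k_1+\cos k_2)-2t_z\cos k_3$ for $\mathbf k\in[-\pi,\pi]^3$, and let $$N_{t_z}(\epsilon)=\int_{[-\pi,\pi]^3}\delta\big(\varepsilon(\mathbf k)-\epsilon\big)\,\frac{dk_1dk_2dk_3}{(2\pi)^3}$$ be the density of states, that is, $N_{t_z}(\epsilon)$ is the derivative at $\epsilon$ of the integrated density of states $E\mapsto(2\pi)^{-3}\,\mathrm{vol}\{\mathbf k\in[-\pi,\pi]^3:\varepsilon(\mathbf k)\le E\}$. **Theorem.** For all sufficiently small $t_z>0$ the integrated density of states is continuously differentiable near $E=0$ (so that $N_{t_z}(0)$ is well defined), the function $t_z\mapsto N_{t_z}(0)$ is infinitely differentiable on $(0,\delta)$ for some $\delta>0$, and, as $t_z\downarrow0$, $$N_{t_z}(0)=P(t_z)+O\Big(t_z^{12}\ln\tfrac1{t_z}\Big),$$ where $$\begin{aligned}P(t_z)={}&\frac{\ln\frac{16}{t_z}}{2\pi^2}+\frac{t_z^2\,(2\ln\frac{16}{t_z}-3)}{128\pi^2}+\frac{27\,t_z^4\,(4\ln\frac{16}{t_z}-7)}{2^{16}\pi^2}+\frac{25\,t_z^6\,(20\ln\frac{16}{t_z}-37)}{2^{21}\pi^2}\\&+\frac{1225\,t_z^8\,(280\ln\frac{16}{t_z}-533)}{2^{33}\pi^2}+\frac{11907}{5}\,\frac{t_z^{10}\,(840\ln\frac{16}{t_z}-1627)}{2^{38}\pi^2}.\end{aligned}$$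 This expansion can be differentiated termwise with respect to $t_z$ any finite number of times: for every integer $n\ge0$, as $t_z\downarrow0$, $$\frac{d^n}{dt_z^n}N_{t_z}(0)=\frac{d^n}{dt_z^n}P(t_z)+O\Big(\frac{d^n}{dt_z^n}\Big[t_z^{12}\ln\tfrac1{t_z}\Big]\Big).$$ -/

import Mathlib

open Real Set Filter Topology MeasureTheory Asymptotics
open scoped ContDiff

noncomputable section

/-- The tight-binding band relation `ε(k) = -2 (cos k₁ + cos k₂) - 2 t_z cos k₃`
(hopping parameter `t = 1` in the horizontal directions). -/
def bandRelation (tz : ℝ) (k : ℝ × ℝ × ℝ) : ℝ :=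
  -2 * (cos k.1 + cos k.2.1) - 2 * tz * cos k.2.2

/-- The Brillouin zone `[-π, π]³`. -/
def brillouinZone : Set (ℝ × ℝ × ℝ) :=
  Icc (-π) π ×ˢ Icc (-π) π ×ˢ Icc (-π) π

/-- The integrated density of states
`∫_{[-π,π]³} 1_{ε(k) ≤ E} dk / (2π)³`, as a function of the energy `E`. -/
def integratedDensityOfStates (tz E : ℝ) : ℝ :=
  (volume {k : ℝ × ℝ × ℝ | k ∈ brillouinZone ∧ bandRelation tz k ≤ E}).toReal / (2 * π) ^ 3

/-- The density of states `N_{t_z}(E) = ∫_{[-π,π]³} δ(ε(k) - E) dk / (2π)³`.  Since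
`δ(ε(k) - E)` is the derivative with respect to `E` of the indicator of `ε(k) ≤ E`,
this is the derivative of the integrated density of states. -/
def densityOfStates (tz E : ℝ) : ℝ :=
  deriv (integratedDensityOfStates tz) E

/-- The asymptotic expansion of `N_{t_z}(0)` as `t_z ↓ 0` through order `t_z ^ 10`. -/
def densityExpansion (tz : ℝ) : ℝ :=
  log (16 / tz) / (2 * π ^ 2)
    + tz ^ 2 * (2 * log (16 / tz) - 3) / (128 * π ^ 2)
    + 27 * tz ^ 4 * (4 * log (16 / tz) - 7) / (2 ^ 16 * π ^ 2)
    + 25 * tz ^ 6 * (20 * log (16 / tz) - 37) / (2 ^ 21 * π ^ 2)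
    + 1225 * tz ^ 8 * (280 * log (16 / tz) - 533) / (2 ^ 33 * π ^ 2)
    + (11907 / 5) * (tz ^ 10 * (840 * log (16 / tz) - 1627) / (2 ^ 38 * π ^ 2))

end

/-! For fixed `k₃`, the planar energy `-2 (cos k₁ + cos k₂)` has, with respect to Lebesgue measure
on the square, the density `2 K'(y / 4)` for `0 < |y| < 4`, where `K'` is the complete elliptic
integral `ellipticKPrime`, logarithmically singular at `0` (`planarWeight_eq`). The
three-dimensional density is the average of this weight over `y = E + 2 t_z cos k₃`. The singularity
is integrable and is crossed transversally when `E` is near `0`, so the average is continuous in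
`E`. The fundamental theorem of calculus then gives `N_{t_z}(0) = π⁻³ ∫₀^{π/2} K'(t_z cos θ / 2) dθ`
(`densityOfStates_zero_eq`).

The integral is expanded exactly. Write `m n = cosMoment n` and `h n = altHarmonicTail n`. The
elementary function `artanh √(1 - c²) / √(1 - c²)` equals `∑ c ^ (2 n) m n (log (1 / c) + h n)`.
Averaging over `c ↦ c cos ψ` multiplies the `n`th coefficient by `m n` and adds one more `h n`
inside the bracket, because the logarithmic moment of the cosine is `m n * h n` (`cosLogMoment_eq`,
`hasSum_average_comp_mul_cos`). One average produces `K'`, and a second produces the density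
integral, with terms `c ^ (2 n) (m n)³ (log (1 / c) + 3 h n)`.

Hence `N_{t_z}(0) = A(t_z) log (1 / t_z) + B(t_z)` with `A` and `B` even power series converging on
`(-1, 1)`. The polynomial `P` collects their first six terms, and the remainder is `t ^ 12` times an
expression of the same shape. Leibniz's rule and the explicit derivatives of `t ^ 12 log (1 / t)`
make the error estimate differentiable (`iteratedDeriv_isBigO_of_eq_log_expansion`). -/

open scoped ENNReal

/-! ### Wallis moments -/

/-- The average of `cos ^ (2 n)` over a quarter period. -/
noncomputable def cosMoment (n : ℕ) : ℝ := (2 / π) * ∫ ψ in (0 : ℝ)..(π / 2), cos ψ ^ (2 * n)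

/-- The average of `-cos ^ (2 n) * log cos` over a quarter period. -/
noncomputable def cosLogMoment (n : ℕ) : ℝ :=
  (2 / π) * ∫ ψ in (0 : ℝ)..(π / 2), cos ψ ^ (2 * n) * (-log (cos ψ))

/-- The alternating harmonic tails `log 2 - 1 + 1 / 2 - ⋯ + 1 / (2 n)`. -/
noncomputable def altHarmonicTail (n : ℕ) : ℝ := ∫ x in (0 : ℝ)..1, x ^ (2 * n) / (1 + x)

lemma cosMoment_zero : cosMoment 0 = 1 := by
  simp [cosMoment]

lemma cosMoment_succ (n : ℕ) :
    cosMoment (n + 1) = (2 * n + 1) / (2 * n + 2) * cosMoment n := by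
  unfold cosMoment
  rw [show 2 * (n + 1) = 2 * n + 2 by ring, integral_cos_pow]
  simp
  ring

lemma cosMoment_nonneg (n : ℕ) : 0 ≤ cosMoment n := by
  induction n with
  | zero => simp [cosMoment_zero]
  | succ n ih => rw [cosMoment_succ]; positivity

lemma cosMoment_le_one (n : ℕ) : cosMoment n ≤ 1 := by
  induction n with
  | zero => simp [cosMoment_zero]
  | succ n ih =>
    rw [cosMoment_succ]
    have h : (2 * n + 1 : ℝ) / (2 * n + 2) ≤ 1 := by
      rw [div_le_one (by positivity)]; linarith
    exact mul_le_one₀ h (cosMoment_nonneg n) ih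

lemma continuousOn_altHarmonicTail_integrand (n : ℕ) :
    ContinuousOn (fun x : ℝ => x ^ (2 * n) / (1 + x)) (uIcc 0 1) := by
  refine ContinuousOn.div (by fun_prop) (by fun_prop) fun x hx => ?_
  rw [uIcc_of_le zero_le_one] at hx
  linarith [hx.1]

lemma altHarmonicTail_zero : altHarmonicTail 0 = log 2 := by
  have h : altHarmonicTail 0 = ∫ x in (0 : ℝ)..1, (1 + x)⁻¹ := by simp [altHarmonicTail]
  rw [h, intervalIntegral.integral_comp_add_left (fun x => x⁻¹) 1, integral_inv_of_pos] <;> norm_num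

lemma altHarmonicTail_succ (n : ℕ) :
    altHarmonicTail (n + 1) = altHarmonicTail n - 1 / (2 * n + 1) + 1 / (2 * n + 2) := by
  have h : altHarmonicTail (n + 1) - altHarmonicTail n
      = ∫ x in (0 : ℝ)..1, (x ^ (2 * n + 1) - x ^ (2 * n)) := by
    unfold altHarmonicTail
    rw [← intervalIntegral.integral_sub
      (continuousOn_altHarmonicTail_integrand _).intervalIntegrable
      (continuousOn_altHarmonicTail_integrand _).intervalIntegrable]
    refine intervalIntegral.integral_congr fun x hx => ?_
    rw [uIcc_of_le zero_le_one] at hx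
    have : 1 + x ≠ 0 := by linarith [hx.1]
    field_simp
    ring
  rw [intervalIntegral.integral_sub (intervalIntegral.intervalIntegrable_pow _)
    (intervalIntegral.intervalIntegrable_pow _), integral_pow, integral_pow] at h
  push_cast at h
  simp at h
  have h2 : (2 * (n : ℝ) + 1 + 1) = 2 * n + 2 := by ring
  rw [h2] at h
  simp only [one_div]
  linarith

lemma altHarmonicTail_nonneg (n : ℕ) : 0 ≤ altHarmonicTail n :=
  intervalIntegral.integral_nonneg zero_le_one fun x hx => by have := hx.1; positivity

lemma altHarmonicTail_le_one (n : ℕ) : altHarmonicTail n ≤ 1 := by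
  have h : altHarmonicTail n ≤ ∫ _ in (0 : ℝ)..1, (1 : ℝ) := by
    refine intervalIntegral.integral_mono_on zero_le_one
      (continuousOn_altHarmonicTail_integrand _).intervalIntegrable
      intervalIntegrable_const fun x hx => ?_
    have h0 := hx.1
    rw [div_le_one (by positivity)]
    exact (pow_le_one₀ h0 hx.2).trans (by linarith)
  simpa using h

lemma cos_pos_of_mem_Ioo_zero {ψ : ℝ} (h : ψ ∈ Ioo 0 (π / 2)) : 0 < cos ψ :=
  cos_pos_of_mem_Ioo ⟨by linarith [h.1, pi_pos], h.2⟩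

lemma intervalIntegrable_cos_pow_mul_log_cos (n : ℕ) :
    IntervalIntegrable (fun ψ => cos ψ ^ (2 * n) * (-log (cos ψ))) volume 0 (π / 2) := by
  have h : IntervalIntegrable (fun ψ => -log (cos ψ)) volume 0 (π / 2) :=
    (intervalIntegrable_log_cos (a := 0) (b := π / 2)).neg
  exact h.continuousOn_mul (by fun_prop)

lemma cosLogMoment_zero : cosLogMoment 0 = log 2 := by
  have h : ∫ ψ in (0 : ℝ)..(π / 2), log (cos ψ) = -log 2 * π / 2 := by
    rw [← integral_log_sin_zero_pi_div_two]
    simp [← sin_pi_div_two_sub,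
      intervalIntegral.integral_comp_sub_left (fun x ↦ log (sin x)) (π / 2)]
  simp [cosLogMoment, h]
  field_simp

/-- Integration by parts: the derivative of `sin ψ cos ψ ^ (2 n + 1) log (cos ψ)` integrates to
zero, since this function vanishes at both ends of the quarter period. -/
lemma cosLogMoment_succ (n : ℕ) :
    cosLogMoment (n + 1) =
      ((2 * n + 1) * cosLogMoment n - cosMoment n / (2 * n + 2)) / (2 * n + 2) := by
  have key : ∫ ψ in (0 : ℝ)..(π / 2), (-(2 * n + 2) * (cos ψ ^ (2 * (n + 1)) * (-log (cos ψ)))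
      + (2 * n + 1) * (cos ψ ^ (2 * n) * (-log (cos ψ)))
      + (cos ψ ^ (2 * (n + 1)) - cos ψ ^ (2 * n))) = 0 := by
    have h := intervalIntegral.integral_eq_sub_of_hasDerivAt_of_le (a := 0) (b := π / 2)
      -- Grouping `cos ψ * log (cos ψ)` gives continuity up to `π / 2` from the continuity of `x log
      -- x`.
      (f := fun ψ => sin ψ * cos ψ ^ (2 * n) * (cos ψ * log (cos ψ))) (f' := fun ψ =>
        (-(2 * n + 2) * (cos ψ ^ (2 * (n + 1)) * (-log (cos ψ)))
      + (2 * n + 1) * (cos ψ ^ (2 * n) * (-log (cos ψ)))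
      + (cos ψ ^ (2 * (n + 1)) - cos ψ ^ (2 * n)))) (by positivity) ?_ ?_ ?_
    · rw [h]; simp
    · have := continuous_mul_log.comp continuous_cos
      exact Continuous.continuousOn (Continuous.mul (by fun_prop) this)
    · intro ψ hψ
      have hc := cos_pos_of_mem_Ioo_zero hψ
      have h1 := ((hasDerivAt_sin ψ).mul ((hasDerivAt_cos ψ).pow (2 * n))).mul
        ((hasDerivAt_cos ψ).mul ((hasDerivAt_cos ψ).log hc.ne'))
      refine h1.congr_deriv ?_
      have hs : sin ψ ^ 2 = 1 - cos ψ ^ 2 := sin_sq ψ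
      -- The exponent `2 n - 1` in the derivative of `cos ψ ^ (2 n)` is truncated at `n = 0`, so
      -- that case is separate.
      rcases n with _ | n
      · simp
        field_simp
        linear_combination (-1 - log (cos ψ)) * hs
      · simp only [Pi.mul_apply, Pi.pow_apply, Nat.cast_mul, Nat.cast_add, Nat.cast_one, Nat.cast_ofNat]
        rw [show 2 * (n + 1) - 1 = 2 * n + 1 by omega]
        field_simp
        ring_nf
        simp only [hs]
        ring
    · exact ((intervalIntegrable_cos_pow_mul_log_cos _).const_mul _).add
        ((intervalIntegrable_cos_pow_mul_log_cos _).const_mul _) |>.add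
        (Continuous.intervalIntegrable (by fun_prop) _ _)
  rw [intervalIntegral.integral_add (((intervalIntegrable_cos_pow_mul_log_cos _).const_mul _).add
        ((intervalIntegrable_cos_pow_mul_log_cos _).const_mul _))
        (Continuous.intervalIntegrable (by fun_prop) _ _),
    intervalIntegral.integral_add ((intervalIntegrable_cos_pow_mul_log_cos _).const_mul _)
        ((intervalIntegrable_cos_pow_mul_log_cos _).const_mul _),
    intervalIntegral.integral_sub (Continuous.intervalIntegrable (by fun_prop) _ _)
      (Continuous.intervalIntegrable (by fun_prop) _ _),
    intervalIntegral.integral_const_mul, intervalIntegral.integral_const_mul] at key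
  have hm := cosMoment_succ n
  unfold cosLogMoment cosMoment at *
  set q0 := ∫ ψ in (0 : ℝ)..(π / 2), cos ψ ^ (2 * n) * (-log (cos ψ))
  set q1 := ∫ ψ in (0 : ℝ)..(π / 2), cos ψ ^ (2 * (n + 1)) * (-log (cos ψ))
  set m0 := ∫ ψ in (0 : ℝ)..(π / 2), cos ψ ^ (2 * n)
  set m1 := ∫ ψ in (0 : ℝ)..(π / 2), cos ψ ^ (2 * (n + 1))
  have hn : (2 * n + 2 : ℝ) ≠ 0 := by positivity
  field_simp at hm ⊢
  linear_combination (-(2 * n + 2)) * key + hm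

/-- The quotient of the two moments obeys the recursion of `altHarmonicTail`, with the same initial
value `log 2`. This is what makes every averaging step add the same number `altHarmonicTail n`. -/
lemma cosLogMoment_eq (n : ℕ) : cosLogMoment n = cosMoment n * altHarmonicTail n := by
  induction n with
  | zero => rw [cosLogMoment_zero, cosMoment_zero, altHarmonicTail_zero, one_mul]
  | succ n ih =>
    rw [cosLogMoment_succ, ih, cosMoment_succ, altHarmonicTail_succ]
    have hn : (2 * n + 2 : ℝ) ≠ 0 := by positivity
    have hn : (2 * n + 1 : ℝ) ≠ 0 := by positivity
    field_simp
    ring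

/-! ### Elementary integrals -/

lemma integral_one_div_one_add_mul_cos_sq {b : ℝ} (hb : -1 < b) :
    ∫ ψ in (0 : ℝ)..(π / 2), 1 / (1 + b * cos ψ ^ 2) = (π / 2) / √(1 + b) := by
  set r := √(1 + b) with hr
  have hr0 : 0 < r := sqrt_pos.2 (by linarith)
  have hr2 : r ^ 2 = 1 + b := sq_sqrt (by linarith)
  have hden : ∀ ψ : ℝ, 0 < r * cos ψ ^ 2 + sin ψ ^ 2 := fun ψ => by
    rcases eq_or_ne (cos ψ) 0 with h | h
    · have := sin_sq_add_cos_sq ψ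
      rw [h] at this ⊢
      nlinarith
    · positivity
  have hpos : ∀ ψ : ℝ, 0 < 1 + b * cos ψ ^ 2 := fun ψ => by
    rcases eq_or_ne (cos ψ) 0 with h | h
    · simp [h]
    · have : 0 < cos ψ ^ 2 := by positivity
      nlinarith [cos_sq_le_one ψ]
  have h := intervalIntegral.integral_eq_sub_of_hasDerivAt (a := 0) (b := π / 2)
    -- This is `arctan (tan ψ / r) / r`, rewritten with the subtraction formula for the tangent so
    -- that it stays smooth at `π / 2`.
    (f := fun ψ => (ψ - arctan ((r - 1) * (sin ψ * cos ψ) / (r * cos ψ ^ 2 + sin ψ ^ 2))) / r)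
    (f' := fun ψ => 1 / (1 + b * cos ψ ^ 2)) ?_ ?_
  · rw [h]; simp
  · intro ψ _
    have h1 := ((hasDerivAt_sin ψ).mul (hasDerivAt_cos ψ)).const_mul (r - 1)
    have h2 := (((hasDerivAt_cos ψ).pow 2).const_mul r).add ((hasDerivAt_sin ψ).pow 2)
    have h3 := ((hasDerivAt_id ψ).sub (h1.div h2 (hden ψ).ne').arctan).div_const r
    refine h3.congr_deriv ?_
    have hd := hden ψ
    have hp := hpos ψ
    have hs : sin ψ ^ 2 = 1 - cos ψ ^ 2 := sin_sq ψ
    have hb' : b = r ^ 2 - 1 := by linarith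
    have hq : 0 < (r * cos ψ ^ 2 + sin ψ ^ 2) ^ 2 + ((r - 1) * (sin ψ * cos ψ)) ^ 2 := by positivity
    have e : (r * cos ψ ^ 2 + sin ψ ^ 2) ^ 2 + ((r - 1) * (sin ψ * cos ψ)) ^ 2
        = 1 + b * cos ψ ^ 2 := by
      rw [hb', mul_pow, mul_pow, hs]; ring
    simp only [Pi.mul_apply, Pi.add_apply, Pi.pow_apply, Pi.div_apply]
    have e2 : 1 + ((r - 1) * (sin ψ * cos ψ) / (r * cos ψ ^ 2 + sin ψ ^ 2)) ^ 2
        = (1 + b * cos ψ ^ 2) / (r * cos ψ ^ 2 + sin ψ ^ 2) ^ 2 := by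
      rw [← e]; field_simp
    have e3 : (r - 1) * (cos ψ * cos ψ + sin ψ * -sin ψ) * (r * cos ψ ^ 2 + sin ψ ^ 2) -
        (r - 1) * (sin ψ * cos ψ) *
          (r * ((2 : ℕ) * cos ψ ^ (2 - 1) * -sin ψ) + (2 : ℕ) * sin ψ ^ (2 - 1) * cos ψ)
        = 1 + b * cos ψ ^ 2 - r := by
      have hs4 : sin ψ ^ 4 = (1 - cos ψ ^ 2) ^ 2 := by rw [← hs]; ring
      rw [hb']
      simp only [Nat.cast_ofNat, Nat.reduceSub, pow_one]
      ring_nf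
      simp only [hs, hs4]
      ring
    rw [e2, e3]
    clear e2 e3 e hq hb' h1 h2 h3
    generalize r * cos ψ ^ 2 + sin ψ ^ 2 = D at hd ⊢
    field_simp
    ring
  · refine Continuous.intervalIntegrable (Continuous.div (by fun_prop) (by fun_prop) ?_) _ _
    exact fun ψ => (hpos ψ).ne'

lemma HasSum.congr_of_eq {f g : ℕ → ℝ} {a b : ℝ} (h : HasSum f a) (hf : ∀ n, g n = f n)
    (ha : b = a) : HasSum g b := by
  rw [ha, funext hf]
  exact h

/-- Termwise integration of the geometric series of `1 / (1 - X cos² ψ)`. -/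
lemma hasSum_cosMoment {X : ℝ} (h0 : 0 ≤ X) (h1 : X < 1) :
    HasSum (fun n => cosMoment n * X ^ n) (1 / √(1 - X)) := by
  have h := intervalIntegral.hasSum_integral_of_dominated_convergence (μ := volume)
    (a := 0) (b := π / 2)
    (F := fun n ψ => X ^ n * cos ψ ^ (2 * n)) (f := fun ψ => 1 / (1 + (-X) * cos ψ ^ 2))
    (fun n _ => X ^ n) (fun n => by fun_prop) (fun n => ae_of_all _ fun ψ _ => ?_)
    (ae_of_all _ fun _ _ => summable_geometric_of_lt_one h0 h1)
    intervalIntegrable_const (ae_of_all _ fun ψ _ => ?_)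
  · rw [integral_one_div_one_add_mul_cos_sq (by linarith)] at h
    have h2 := h.mul_left (2 / π)
    refine h2.congr_of_eq (fun n => ?_) ?_
    · rw [cosMoment, intervalIntegral.integral_const_mul]; ring
    · rw [← sub_eq_add_neg]; field_simp
  · rw [norm_mul, norm_pow, norm_pow, pow_mul, norm_of_nonneg h0]
    exact mul_le_of_le_one_right (by positivity)
      (pow_le_one₀ (by positivity) (by simpa using cos_sq_le_one ψ))
  · have hq : X * cos ψ ^ 2 < 1 := by nlinarith [cos_sq_le_one ψ, sq_nonneg (cos ψ)]
    have := hasSum_geometric_of_lt_one (r := X * cos ψ ^ 2) (by positivity) hq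
    refine this.congr_of_eq (fun n => ?_) ?_
    · rw [mul_pow, pow_mul]
    · rw [one_div]; ring_nf

lemma integral_one_div_one_add_mul_sqrt {X : ℝ} (h0 : 0 ≤ X) (h1 : X < 1) :
    ∫ x in (0 : ℝ)..1, 1 / ((1 + x) * √(1 - X * x ^ 2)) = log (1 + √(1 - X)) / √(1 - X) := by
  set s := √(1 - X) with hs
  have hs0 : 0 < s := sqrt_pos.2 (by linarith)
  have hs2 : s ^ 2 = 1 - X := sq_sqrt (by linarith)
  have hpos : ∀ x ∈ Icc (0 : ℝ) 1, 0 < 1 - X * x ^ 2 := fun x hx => by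
    have : x ^ 2 ≤ 1 := pow_le_one₀ hx.1 hx.2
    nlinarith
  have h := intervalIntegral.integral_eq_sub_of_hasDerivAt (a := 0) (b := 1)
    -- The logarithm vanishes at `x = 1`, because `1 + X + s ^ 2 = 2`, and equals `log (1 + s)` at
    -- `x = 0`.
    (f := fun x => -(log ((1 + X * x + s * √(1 - X * x ^ 2)) / (1 + x))) / s)
    (f' := fun x => 1 / ((1 + x) * √(1 - X * x ^ 2))) ?_ ?_
  · rw [h]
    simp [← hs]
    rw [← sq, hs2]
    norm_num
    ring
  · intro x hx
    rw [uIcc_of_le zero_le_one] at hx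
    have hx0 := hx.1
    have hp := hpos x hx
    have hq0 := sqrt_pos.2 hp
    have h2 := (((hasDerivAt_pow 2 x).const_mul X).const_sub 1).sqrt hp.ne'
    have h3 := (((hasDerivAt_id x).const_mul X).const_add 1).add (h2.const_mul s)
    have h4 := (hasDerivAt_id x).const_add 1
    have hnum : 0 < 1 + X * x + s * √(1 - X * x ^ 2) := by positivity
    have h5 := ((h3.div h4 (by simp; positivity)).log
      (by simp only [Pi.div_apply, Pi.add_apply, id]; positivity)).neg.div_const s
    refine h5.congr_deriv ?_
    have hq2 : √(1 - X * x ^ 2) ^ 2 = 1 - X * x ^ 2 := sq_sqrt hp.le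
    set q := √(1 - X * x ^ 2)
    simp only [Pi.add_apply, id, Nat.cast_ofNat, Nat.reduceSub, pow_one, Pi.div_apply]
    have hx1 : 0 < 1 + x := by linarith
    field_simp
    linear_combination (-q) * hs2 + s * hq2
  · refine ContinuousOn.intervalIntegrable fun x hx => ?_
    rw [uIcc_of_le zero_le_one] at hx
    have hq0 := sqrt_pos.2 (hpos x hx)
    have hx1 : 0 < 1 + x := by linarith [hx.1]
    exact ContinuousAt.continuousWithinAt
      (ContinuousAt.div (by fun_prop) (by fun_prop) (by positivity))

/-! ### The complete elliptic integral of the first kind -/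

/-- The complete elliptic integral of the first kind with complementary modulus `c`. -/
noncomputable def ellipticKPrime (c : ℝ) : ℝ :=
  ∫ φ in (0 : ℝ)..(π / 2), 1 / √(cos φ ^ 2 + c ^ 2 * sin φ ^ 2)

/-- `artanh √(1 - X) / √(1 - X)`. -/
noncomputable def artanhKernel (X : ℝ) : ℝ :=
  (log (1 + √(1 - X)) + log (1 / X) / 2) / √(1 - X)

/-- Expand `1 / √(1 - X x²)` with `hasSum_cosMoment` and integrate against `1 / (1 + x)`; the
moments `∫ x ^ (2 n) / (1 + x)` are the harmonic tails. -/
lemma hasSum_log_one_add_sqrt {X : ℝ} (h0 : 0 ≤ X) (h1 : X < 1) :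
    HasSum (fun n => cosMoment n * altHarmonicTail n * X ^ n)
      (log (1 + √(1 - X)) / √(1 - X)) := by
  have h := intervalIntegral.hasSum_integral_of_dominated_convergence (μ := volume)
    (a := 0) (b := 1)
    (F := fun n x => cosMoment n * X ^ n * (x ^ (2 * n) / (1 + x)))
    (f := fun x => 1 / ((1 + x) * √(1 - X * x ^ 2)))
    (fun n _ => X ^ n) (fun n => Measurable.aestronglyMeasurable (by fun_prop))
    (fun n => ae_of_all _ fun x hx => ?_)
    (ae_of_all _ fun _ _ => summable_geometric_of_lt_one h0 h1)
    intervalIntegrable_const (ae_of_all _ fun x hx => ?_)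
  · rw [integral_one_div_one_add_mul_sqrt h0 h1] at h
    refine h.congr_of_eq (fun n => ?_) rfl
    rw [altHarmonicTail, intervalIntegral.integral_const_mul]; ring
  all_goals
    rw [uIoc_of_le zero_le_one] at hx
    have hx0 := hx.1
  · rw [norm_of_nonneg (by have := cosMoment_nonneg n; positivity)]
    have e1 : x ^ (2 * n) / (1 + x) ≤ 1 := by
      rw [div_le_one (by positivity)]
      exact (pow_le_one₀ hx0.le hx.2).trans (by linarith)
    have e2 : cosMoment n * X ^ n ≤ 1 * X ^ n := by gcongr; exact cosMoment_le_one n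
    rw [one_mul] at e2
    exact (mul_le_mul e2 e1 (by positivity) (by positivity)).trans (by simp)
  · have hx2 : x ^ 2 ≤ 1 := pow_le_one₀ hx0.le hx.2
    have h2 := (hasSum_cosMoment (X := X * x ^ 2) (by positivity) (by nlinarith)).mul_right
      (1 / (1 + x))
    refine h2.congr_of_eq (fun n => ?_) ?_
    · rw [mul_pow, pow_mul]; ring
    · rw [div_mul_div_comm, one_mul, mul_comm]

lemma hasSum_artanhKernel {c : ℝ} (h0 : 0 < c) (h1 : c < 1) :
    HasSum (fun n => c ^ (2 * n) * (cosMoment n * log (1 / c) + cosMoment n * altHarmonicTail n))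
      (artanhKernel (c ^ 2)) := by
  have hc : c ^ 2 < 1 := pow_lt_one₀ h0.le h1 two_ne_zero
  have e1 := (hasSum_cosMoment (sq_nonneg c) hc).mul_left (log (1 / c))
  have e2 := hasSum_log_one_add_sqrt (sq_nonneg c) hc
  refine (e1.add e2).congr_of_eq (fun n => ?_) ?_
  · rw [pow_mul]; ring
  · rw [artanhKernel, one_div (c ^ 2), log_inv, log_pow, one_div c, log_inv]
    push_cast
    ring

lemma integral_cos_div_cos_sq_add_mul_sin_sq {X : ℝ} (h0 : 0 < X) (h1 : X < 1) :
    ∫ φ in (0 : ℝ)..(π / 2), cos φ / (cos φ ^ 2 + X * sin φ ^ 2) = artanhKernel X := by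
  set s := √(1 - X) with hs
  have hs0 : 0 < s := sqrt_pos.2 (by linarith)
  have hs2 : s ^ 2 = 1 - X := sq_sqrt (by linarith)
  have hs1 : s < 1 := by nlinarith
  have hp : ∀ φ : ℝ, 0 < 1 + s * sin φ := fun φ => by nlinarith [neg_one_le_sin φ]
  have hm : ∀ φ : ℝ, 0 < 1 - s * sin φ := fun φ => by nlinarith [sin_le_one φ]
  have hq : ∀ φ : ℝ, cos φ ^ 2 + X * sin φ ^ 2 = (1 + s * sin φ) * (1 - s * sin φ) := fun φ => by
    rw [cos_sq']; linear_combination (sin φ ^ 2) * hs2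
  have h := intervalIntegral.integral_eq_sub_of_hasDerivAt (a := 0) (b := π / 2)
    (f := fun φ => (log (1 + s * sin φ) - log (1 - s * sin φ)) / (2 * s))
    (f' := fun φ => cos φ / (cos φ ^ 2 + X * sin φ ^ 2)) ?_ ?_
  · rw [h, artanhKernel, ← hs]
    have e : X = (1 + s) * (1 - s) := by linear_combination hs2
    have e2 : log (1 / X) = -log (1 + s) - log (1 - s) := by
      rw [one_div, log_inv, e, log_mul (by linarith) (by linarith)]; ring
    rw [e2]
    simp
    field_simp
    ring
  · intro φ _
    have h1 := (((hasDerivAt_sin φ).const_mul s).const_add 1).log (hp φ).ne'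
    have h2 := (((hasDerivAt_sin φ).const_mul s).const_sub 1).log (hm φ).ne'
    refine ((h1.sub h2).div_const (2 * s)).congr_deriv ?_
    rw [hq]
    have := hp φ
    have := hm φ
    field_simp
    ring
  · refine Continuous.intervalIntegrable (Continuous.div (by fun_prop) (by fun_prop) ?_) _ _
    intro φ
    rw [hq]
    exact (mul_pos (hp φ) (hm φ)).ne'

/-- Tonelli for the nonnegative kernel `cos φ / (cos² φ + c² cos² ψ sin² φ)`: the `ψ` integral gives
`π / 2` times the integrand of `ellipticKPrime`, the `φ` integral gives `artanhKernel`. Working with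
lower integrals avoids an integrability proof for the swap. -/
lemma ellipticKPrime_eq_integral_artanhKernel {c : ℝ} (h0 : 0 < c) (h1 : c < 1) :
    ellipticKPrime c = (2 / π) * ∫ ψ in (0 : ℝ)..(π / 2), artanhKernel (c ^ 2 * cos ψ ^ 2) := by
  have hpi : (0 : ℝ) ≤ π / 2 := by positivity
  set μ := volume.restrict (Ioo (0 : ℝ) (π / 2)) with hμ
  set k : ℝ → ℝ → ℝ := fun φ ψ => cos φ / (cos φ ^ 2 + c ^ 2 * cos ψ ^ 2 * sin φ ^ 2) with hk
  have hk0 : ∀ φ ∈ Ioo 0 (π / 2), ∀ ψ, 0 ≤ k φ ψ := fun φ hφ ψ => by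
    have := cos_pos_of_mem_Ioo_zero hφ
    positivity
  have swap : ∫⁻ φ, ∫⁻ ψ, ENNReal.ofReal (k φ ψ) ∂μ ∂μ = ∫⁻ ψ, ∫⁻ φ, ENNReal.ofReal (k φ ψ) ∂μ ∂μ := by
    refine lintegral_lintegral_swap ?_
    refine Measurable.aemeasurable ?_
    simp only [hk, Function.uncurry_def]
    fun_prop
  have inner1 : ∀ φ ∈ Ioo 0 (π / 2), ∫⁻ ψ, ENNReal.ofReal (k φ ψ) ∂μ
      = ENNReal.ofReal ((π / 2) * (1 / √(cos φ ^ 2 + c ^ 2 * sin φ ^ 2))) := fun φ hφ => by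
    have hc := cos_pos_of_mem_Ioo_zero hφ
    have hb : 0 ≤ c ^ 2 * (sin φ / cos φ) ^ 2 := by positivity
    have hcont : Continuous (k φ) := by
      refine Continuous.div (by fun_prop) (by fun_prop) fun ψ => ?_
      positivity
    rw [← ofReal_integral_eq_lintegral_ofReal]
    · congr 1
      rw [hμ, ← integral_Ioc_eq_integral_Ioo, ← intervalIntegral.integral_of_le hpi]
      have e : ∀ ψ, k φ ψ = (1 / cos φ) * (1 / (1 + c ^ 2 * (sin φ / cos φ) ^ 2 * cos ψ ^ 2)) :=
        fun ψ => by
          simp only [hk]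
          have : cos φ ^ 2 + c ^ 2 * cos ψ ^ 2 * sin φ ^ 2 ≠ 0 := by positivity
          field_simp
      simp only [e]
      rw [intervalIntegral.integral_const_mul,
        integral_one_div_one_add_mul_cos_sq (by linarith)]
      have e2 : 1 + c ^ 2 * (sin φ / cos φ) ^ 2 = (cos φ ^ 2 + c ^ 2 * sin φ ^ 2) / cos φ ^ 2 := by
        field_simp
      rw [e2, sqrt_div' _ (by positivity), sqrt_sq hc.le]
      field_simp
    · exact (hcont.integrableOn_Ioc).mono_set Ioo_subset_Ioc_self
    · exact ae_of_all _ fun ψ => hk0 φ hφ ψ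
  have hX : ∀ ψ ∈ Ioo 0 (π / 2), 0 < c ^ 2 * cos ψ ^ 2 ∧ c ^ 2 * cos ψ ^ 2 < 1 := fun ψ hψ => by
    have hc := cos_pos_of_mem_Ioo_zero hψ
    refine ⟨by positivity, ?_⟩
    nlinarith [cos_sq_le_one ψ, pow_lt_one₀ h0.le h1 two_ne_zero]
  have inner2 : ∀ ψ ∈ Ioo 0 (π / 2), ∫⁻ φ, ENNReal.ofReal (k φ ψ) ∂μ
      = ENNReal.ofReal (artanhKernel (c ^ 2 * cos ψ ^ 2)) := fun ψ hψ => by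
    have hc := cos_pos_of_mem_Ioo_zero hψ
    have hcont : Continuous (fun φ => k φ ψ) := by
      refine Continuous.div (by fun_prop) (by fun_prop) fun φ => ?_
      rcases eq_or_ne (cos φ) 0 with h | h
      · have := sin_sq_add_cos_sq φ
        rw [h] at this ⊢
        have h2 : sin φ ^ 2 = 1 := by linarith
        rw [h2]
        positivity
      · positivity
    rw [← ofReal_integral_eq_lintegral_ofReal]
    · congr 1
      rw [hμ, ← integral_Ioc_eq_integral_Ioo, ← intervalIntegral.integral_of_le hpi]
      exact integral_cos_div_cos_sq_add_mul_sin_sq (hX ψ hψ).1 (hX ψ hψ).2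
    · exact (hcont.integrableOn_Ioc).mono_set Ioo_subset_Ioc_self
    · exact (ae_restrict_iff' measurableSet_Ioo).2 (ae_of_all _ fun φ hφ => hk0 φ hφ ψ)
  rw [setLIntegral_congr_fun measurableSet_Ioo inner1,
    setLIntegral_congr_fun measurableSet_Ioo inner2] at swap
  have r1 : (π / 2) * ellipticKPrime c
      = (∫⁻ φ, ENNReal.ofReal ((π / 2) * (1 / √(cos φ ^ 2 + c ^ 2 * sin φ ^ 2))) ∂μ).toReal := by
    rw [ellipticKPrime, ← intervalIntegral.integral_const_mul,
      intervalIntegral.integral_of_le hpi, integral_Ioc_eq_integral_Ioo,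
      integral_eq_lintegral_of_nonneg_ae]
    · exact ae_of_all _ fun φ => by positivity
    · exact Measurable.aestronglyMeasurable (by fun_prop)
  have r2 : ∫ ψ in (0 : ℝ)..(π / 2), artanhKernel (c ^ 2 * cos ψ ^ 2)
      = (∫⁻ ψ, ENNReal.ofReal (artanhKernel (c ^ 2 * cos ψ ^ 2)) ∂μ).toReal := by
    rw [intervalIntegral.integral_of_le hpi, integral_Ioc_eq_integral_Ioo,
      integral_eq_lintegral_of_nonneg_ae]
    · refine (ae_restrict_iff' measurableSet_Ioo).2 (ae_of_all _ fun ψ hψ => ?_)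
      obtain ⟨ha, hb⟩ := hX ψ hψ
      have l1 : 0 ≤ log (1 + √(1 - c ^ 2 * cos ψ ^ 2)) :=
        log_nonneg (by linarith [sqrt_nonneg (1 - c ^ 2 * cos ψ ^ 2)])
      have l2 : 0 ≤ log (1 / (c ^ 2 * cos ψ ^ 2)) :=
        log_nonneg (by rw [le_div_iff₀ ha]; linarith)
      simp only [artanhKernel, Pi.zero_apply]
      positivity
    · refine Measurable.aestronglyMeasurable ?_
      unfold artanhKernel
      fun_prop
  rw [r2, ← swap, ← r1]
  field_simp

/-- The engine of the expansion. Since `log (1 / (c cos ψ)) = log (1 / c) - log (cos ψ)`, averaging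
a logarithmic power series acts diagonally on the powers of `c`. The sum and the integral are
exchanged under the bound `c ^ (2 n) (log (1 / c) - log (cos ψ) + B)`, whose logarithm is
integrable. -/
lemma hasSum_average_comp_mul_cos {u v : ℕ → ℝ} {B : ℝ} {h : ℝ → ℝ}
    (hu : ∀ n, |u n| ≤ 1) (hv : ∀ n, |v n| ≤ B)
    (hh : ∀ c ∈ Ioo (0 : ℝ) 1, HasSum (fun n => c ^ (2 * n) * (u n * log (1 / c) + v n)) (h c))
    {c : ℝ} (hc : c ∈ Ioo (0 : ℝ) 1) :
    HasSum (fun n => c ^ (2 * n) * (u n * cosMoment n * log (1 / c)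
        + (v n * cosMoment n + u n * cosLogMoment n)))
      ((2 / π) * ∫ ψ in (0 : ℝ)..(π / 2), h (c * cos ψ)) := by
  have hpi : (0 : ℝ) ≤ π / 2 := by positivity
  have hc0 := hc.1
  have hL : 0 ≤ log (1 / c) := log_nonneg (by rw [le_div_iff₀ hc.1]; linarith [hc.2])
  have hsum : Summable fun n => c ^ (2 * n) := by
    simp only [pow_mul]
    exact summable_geometric_of_lt_one (by positivity) (pow_lt_one₀ hc0.le hc.2 two_ne_zero)
  have hlog : IntervalIntegrable (fun ψ => -log (cos ψ)) volume 0 (π / 2) :=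
    (intervalIntegrable_log_cos (a := 0) (b := π / 2)).neg
  have key := intervalIntegral.hasSum_integral_of_dominated_convergence (μ := volume)
    (a := 0) (b := π / 2)
    (F := fun n ψ => (c * cos ψ) ^ (2 * n) * (u n * (log (1 / c) + -log (cos ψ)) + v n))
    (f := fun ψ => h (c * cos ψ))
    (fun n ψ => c ^ (2 * n) * (log (1 / c) + -log (cos ψ) + B))
    (fun n => Measurable.aestronglyMeasurable (by fun_prop))
    (fun n => ae_of_all _ fun ψ hψ => ?_)
    (ae_of_all _ fun ψ _ => hsum.mul_right _) ?_ ?_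
  · refine (key.mul_left (2 / π)).congr_of_eq (fun n => ?_) rfl
    have e : ∀ ψ, (c * cos ψ) ^ (2 * n) * (u n * (log (1 / c) + -log (cos ψ)) + v n)
        = c ^ (2 * n) * (u n * log (1 / c) + v n) * cos ψ ^ (2 * n)
          + c ^ (2 * n) * u n * (cos ψ ^ (2 * n) * (-log (cos ψ))) := fun ψ => by
      rw [mul_pow]; ring
    simp only [e]
    rw [intervalIntegral.integral_add (Continuous.intervalIntegrable (by fun_prop) _ _)
      ((intervalIntegrable_cos_pow_mul_log_cos n).const_mul _),
      intervalIntegral.integral_const_mul, intervalIntegral.integral_const_mul,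
      cosMoment, cosLogMoment]
    ring
  · rw [uIoc_of_le hpi] at hψ
    have h0 : 0 ≤ cos ψ := cos_nonneg_of_mem_Icc ⟨by linarith [hψ.1], hψ.2⟩
    have h1 : 0 ≤ -log (cos ψ) := by
      have := log_nonpos h0 (cos_le_one ψ); linarith
    have hB : 0 ≤ B := (abs_nonneg _).trans (hv 0)
    rw [norm_mul, norm_pow, norm_of_nonneg (by positivity : 0 ≤ c * cos ψ), mul_pow]
    refine mul_le_mul (mul_le_of_le_one_right (by positivity) (pow_le_one₀ h0 (cos_le_one ψ)))
      ?_ (norm_nonneg _) (by positivity)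
    refine (norm_add_le _ _).trans (add_le_add ?_ (hv n))
    rw [norm_mul, norm_of_nonneg (by positivity : 0 ≤ log (1 / c) + -log (cos ψ))]
    exact mul_le_of_le_one_left (by positivity) (hu n)
  · simp only [tsum_mul_right]
    exact ((intervalIntegrable_const.add hlog).add intervalIntegrable_const).const_mul _
  -- The endpoint `π / 2` is discarded, since the cosine vanishes there and the series hypothesis
  -- needs a positive argument.
  · filter_upwards [(countable_singleton (π / 2)).ae_notMem volume] with ψ hne hψ
    rw [uIoc_of_le hpi] at hψ
    have hcos := cos_pos_of_mem_Ioo_zero ⟨hψ.1, lt_of_le_of_ne hψ.2 hne⟩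
    have hlt : c * cos ψ < 1 := by nlinarith [cos_le_one ψ, hc.2]
    refine (hh (c * cos ψ) ⟨by positivity, hlt⟩).congr_of_eq (fun n => ?_) rfl
    rw [one_div, one_div, log_inv, log_inv, log_mul hc0.ne' hcos.ne']
    ring

lemma abs_cosMoment_pow_le_one (n k : ℕ) : |cosMoment n ^ k| ≤ 1 := by
  rw [abs_of_nonneg (pow_nonneg (cosMoment_nonneg n) k)]
  exact pow_le_one₀ (cosMoment_nonneg n) (cosMoment_le_one n)

lemma hasSum_ellipticKPrime {c : ℝ} (hc : c ∈ Ioo (0 : ℝ) 1) :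
    HasSum (fun n => c ^ (2 * n) * (cosMoment n ^ 2 * log (1 / c)
      + 2 * cosMoment n ^ 2 * altHarmonicTail n)) (ellipticKPrime c) := by
  have h := hasSum_average_comp_mul_cos (u := cosMoment)
    (v := fun n => cosMoment n * altHarmonicTail n) (B := 1) (h := fun c => artanhKernel (c ^ 2))
    (fun n => by simpa using abs_cosMoment_pow_le_one n 1)
    (fun n => by
      rw [abs_of_nonneg (mul_nonneg (cosMoment_nonneg n) (altHarmonicTail_nonneg n))]
      exact mul_le_one₀ (cosMoment_le_one n) (altHarmonicTail_nonneg n) (altHarmonicTail_le_one n))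
    (fun c hc => hasSum_artanhKernel hc.1 hc.2) hc
  simp only [mul_pow] at h
  rw [← ellipticKPrime_eq_integral_artanhKernel hc.1 hc.2] at h
  refine h.congr_of_eq (fun n => ?_) rfl
  rw [cosLogMoment_eq]
  ring

lemma hasSum_average_ellipticKPrime {c : ℝ} (hc : c ∈ Ioo (0 : ℝ) 1) :
    HasSum (fun n => c ^ (2 * n) * (cosMoment n ^ 3 * log (1 / c)
        + 3 * cosMoment n ^ 3 * altHarmonicTail n))
      ((2 / π) * ∫ θ in (0 : ℝ)..(π / 2), ellipticKPrime (c * cos θ)) := by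
  have h := hasSum_average_comp_mul_cos (u := fun n => cosMoment n ^ 2)
    (v := fun n => 2 * cosMoment n ^ 2 * altHarmonicTail n) (B := 2)
    (fun n => abs_cosMoment_pow_le_one n 2)
    (fun n => by
      rw [abs_mul, abs_mul, abs_of_nonneg (altHarmonicTail_nonneg n)]
      have h2 := abs_cosMoment_pow_le_one n 2
      have h3 := altHarmonicTail_le_one n
      have h4 := altHarmonicTail_nonneg n
      rw [abs_of_pos (by norm_num : (0 : ℝ) < 2)]
      nlinarith [mul_le_one₀ h2 h4 h3])
    (fun c hc => hasSum_ellipticKPrime hc) hc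
  refine h.congr_of_eq (fun n => ?_) rfl
  rw [cosLogMoment_eq]
  ring

/-! ### Expansion of the averaged elliptic integral -/

/-- The coefficients of `t ^ (2 n) * log (1 / t)` in the expansion of the density of states. -/
noncomputable def logCoeff (n : ℕ) : ℝ := cosMoment n ^ 3 / 4 ^ n / (2 * π ^ 2)

/-- The coefficients of `t ^ (2 n)` in the expansion of the density of states. -/
noncomputable def regCoeff (n : ℕ) : ℝ := logCoeff n * (log 2 + 3 * altHarmonicTail n)

lemma logCoeff_nonneg (n : ℕ) : 0 ≤ logCoeff n := by
  have := cosMoment_nonneg n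
  unfold logCoeff; positivity

lemma logCoeff_le_one (n : ℕ) : logCoeff n ≤ 1 := by
  have h := pow_le_one₀ (cosMoment_nonneg n) (cosMoment_le_one n) (n := 3)
  have h4 : (1 : ℝ) ≤ 4 ^ n := one_le_pow₀ (by norm_num)
  have hp : 1 ≤ 2 * π ^ 2 := by nlinarith [pi_gt_three]
  unfold logCoeff
  rw [div_div, div_le_one (by positivity)]
  nlinarith

lemma abs_logCoeff_le (n : ℕ) : |logCoeff n| ≤ 4 := by
  rw [abs_of_nonneg (logCoeff_nonneg n)]; linarith [logCoeff_le_one n]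

lemma abs_regCoeff_le (n : ℕ) : |regCoeff n| ≤ 4 := by
  have h2 : 0 ≤ log 2 := log_nonneg (by norm_num)
  have h3 : log 2 ≤ 1 := by linarith [log_two_lt_d9]
  have h4 := altHarmonicTail_le_one n
  have h5 := altHarmonicTail_nonneg n
  have h6 := logCoeff_nonneg n
  have h7 := logCoeff_le_one n
  unfold regCoeff
  rw [abs_of_nonneg (by positivity)]
  nlinarith

/-- Substituting `c = t / 2` produces the factor `4 ^ n` in `logCoeff` and the extra `log 2` in
`regCoeff`. -/
lemma hasSum_densityIntegral {t : ℝ} (ht : t ∈ Ioo (0 : ℝ) 1) :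
    HasSum (fun n => logCoeff n * t ^ (2 * n) * log (1 / t) + regCoeff n * t ^ (2 * n))
      (1 / π ^ 3 * ∫ θ in (0 : ℝ)..(π / 2), ellipticKPrime (t / 2 * cos θ)) := by
  have h := hasSum_average_ellipticKPrime (c := t / 2) ⟨by linarith [ht.1], by linarith [ht.2]⟩
  refine (h.mul_left (1 / (2 * π ^ 2))).congr_of_eq (fun n => ?_) ?_
  · have e : log (1 / (t / 2)) = log (1 / t) + log 2 := by
      rw [show 1 / (t / 2) = 1 / t * 2 by field_simp,
        log_mul (one_div_ne_zero ht.1.ne') two_ne_zero]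
    rw [e, regCoeff, logCoeff, div_pow, pow_mul 2 2 n]
    norm_num
    ring
  · field_simp

/-! ### Even power series with bounded coefficients -/

/-- The sum of the power series `∑ a n * t ^ (2 n)`. -/
noncomputable def evenSeries (a : ℕ → ℝ) (t : ℝ) : ℝ := ∑' n, a n * t ^ (2 * n)

lemma hasSum_evenSeries {a : ℕ → ℝ} {C : ℝ} (ha : ∀ n, |a n| ≤ C) {t : ℝ}
    (ht : t ∈ Ioo (-1 : ℝ) 1) : HasSum (fun n => a n * t ^ (2 * n)) (evenSeries a t) := by
  have ht2 : t ^ 2 < 1 := by nlinarith [ht.1, ht.2]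
  refine Summable.hasSum (Summable.of_norm_bounded
    ((summable_geometric_of_lt_one (sq_nonneg t) ht2).mul_left C) fun n => ?_)
  rw [norm_mul, pow_mul, norm_of_nonneg (r := (t ^ 2) ^ n) (by positivity)]
  exact mul_le_mul_of_nonneg_right (ha n) (by positivity)

/-- Bounded coefficients give radius of convergence at least `1`; the even series is the resulting
analytic function composed with `t ↦ t ^ 2`. -/
lemma contDiffOn_evenSeries {a : ℕ → ℝ} {C : ℝ} (ha : ∀ n, |a n| ≤ C) :
    ContDiffOn ℝ ∞ (evenSeries a) (Ioo (-1) 1) := by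
  set p := FormalMultilinearSeries.ofScalars ℝ a with hp
  have hr : (1 : ENNReal) ≤ p.radius := by
    have := p.le_radius_of_bound (r := 1) C fun n => by
      rw [hp, FormalMultilinearSeries.ofScalars_norm]
      simpa using ha n
    simpa using this
  have hball := (p.hasFPowerSeriesOnBall (lt_of_lt_of_le zero_lt_one hr)).mono zero_lt_one hr
  have han : AnalyticOnNhd ℝ p.sum (Metric.eball 0 1) := hball.analyticOnNhd
  intro t ht
  have ht2 : t ^ 2 < 1 := by nlinarith [ht.1, ht.2]
  have hmem : t ^ 2 ∈ Metric.eball (0 : ℝ) 1 := by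
    rw [Metric.mem_eball, edist_dist, dist_zero_right, norm_of_nonneg (sq_nonneg t)]
    simpa using ht2
  have h1 : ContDiffAt ℝ ∞ (fun t => p.sum (t ^ 2)) t :=
    ContDiffAt.comp (g := p.sum) (f := fun t : ℝ => t ^ 2) t (han _ hmem).contDiffAt (by fun_prop)
  refine (h1.congr_of_eventuallyEq (Eventually.of_forall fun s => ?_)).contDiffWithinAt
  simp only [evenSeries, FormalMultilinearSeries.sum, hp,
    FormalMultilinearSeries.ofScalars_apply_eq, smul_eq_mul, pow_mul]

lemma densityIntegral_eq {t : ℝ} (ht : t ∈ Ioo (0 : ℝ) 1) :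
    1 / π ^ 3 * ∫ θ in (0 : ℝ)..(π / 2), ellipticKPrime (t / 2 * cos θ)
      = evenSeries logCoeff t * log (1 / t) + evenSeries regCoeff t := by
  have ht' : t ∈ Ioo (-1 : ℝ) 1 := ⟨by linarith [ht.1], ht.2⟩
  exact (hasSum_densityIntegral ht).unique
    (((hasSum_evenSeries abs_logCoeff_le ht').mul_right _).add
      (hasSum_evenSeries abs_regCoeff_le ht'))

lemma evenSeries_eq_sum_add {a : ℕ → ℝ} {C : ℝ} (ha : ∀ n, |a n| ≤ C) (k : ℕ) {t : ℝ}
    (ht : t ∈ Ioo (-1 : ℝ) 1) :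
    evenSeries a t = ∑ n ∈ Finset.range k, a n * t ^ (2 * n)
      + t ^ (2 * k) * evenSeries (fun n => a (n + k)) t := by
  have h := (hasSum_evenSeries ha ht).summable.sum_add_tsum_nat_add k
  rw [evenSeries, ← h, evenSeries, ← tsum_mul_left]
  congr 2
  funext n
  rw [mul_add, pow_add]
  ring

/-- The number `16` arises because `regCoeff` contains `log 2` four times: once from `t / 2`, and
once from each of its three harmonic tails. -/
lemma densityExpansion_eq {t : ℝ} (ht : 0 < t) :
    densityExpansion t = (∑ n ∈ Finset.range 6, logCoeff n * t ^ (2 * n)) * log (1 / t)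
      + ∑ n ∈ Finset.range 6, regCoeff n * t ^ (2 * n) := by
  have h16 : log (16 / t) = log (1 / t) + 4 * log 2 := by
    rw [show 16 / t = 1 / t * 2 ^ 4 by field_simp; norm_num,
      log_mul (by positivity) (by positivity), log_pow]
    norm_num
  have hpi : π ≠ 0 := pi_ne_zero
  simp only [Finset.sum_range_succ, Finset.sum_range_zero, regCoeff, logCoeff, cosMoment_succ,
    cosMoment_zero, altHarmonicTail_succ, altHarmonicTail_zero, densityExpansion, h16]
  norm_num
  field_simp
  ring

lemma densityIntegral_sub_densityExpansion {t : ℝ} (ht : t ∈ Ioo (0 : ℝ) 1) :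
    1 / π ^ 3 * (∫ θ in (0 : ℝ)..(π / 2), ellipticKPrime (t / 2 * cos θ)) - densityExpansion t
      = evenSeries (fun n => logCoeff (n + 6)) t * (t ^ 12 * log (1 / t))
        + evenSeries (fun n => regCoeff (n + 6)) t * t ^ 12 := by
  have ht' : t ∈ Ioo (-1 : ℝ) 1 := ⟨by linarith [ht.1], ht.2⟩
  rw [densityIntegral_eq ht, densityExpansion_eq ht.1,
    evenSeries_eq_sum_add abs_logCoeff_le 6 ht', evenSeries_eq_sum_add abs_regCoeff_le 6 ht']
  ring

/-! ### Termwise differentiation of logarithmic expansions -/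

lemma hasDerivAt_zpow_mul_log_one_div (k : ℤ) (α β : ℝ) {t : ℝ} (ht : 0 < t) :
    HasDerivAt (fun s => s ^ k * (α * log (1 / s) + β))
      (t ^ (k - 1) * (k * α * log (1 / t) + (k * β - α))) t := by
  have h1 := hasDerivAt_zpow k t (Or.inl ht.ne')
  have h2 := (((hasDerivAt_log ht.ne').neg).const_mul α).add_const β
  have h3 := h1.mul h2
  have e : (fun s : ℝ => s ^ k * (α * log (1 / s) + β))
      = (fun s => s ^ k) * fun s => α * (-log) s + β := by
    funext s
    simp [one_div, log_inv]
  rw [e]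
  refine h3.congr_deriv ?_
  rw [one_div, log_inv, zpow_sub_one₀ ht.ne']
  simp only [Pi.neg_apply]
  ring

/-- Each derivative multiplies `α` by `m - j`. The logarithm thus survives up to order `m` and
disappears at order `m + 1`, where `β` becomes `-α`; afterwards `β` is multiplied by nonzero
integers. The nonvanishing clauses keep the error scale from degenerating at any order. -/
lemma iteratedDeriv_pow_mul_log_one_div (m j : ℕ) :
    ∃ α β : ℝ, (j ≤ m → α ≠ 0) ∧ (m < j → α = 0 ∧ β ≠ 0) ∧ ∀ t : ℝ, 0 < t →
      iteratedDeriv j (fun s : ℝ => s ^ m * log (1 / s)) t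
        = t ^ ((m : ℤ) - j) * (α * log (1 / t) + β) := by
  induction j with
  | zero => exact ⟨1, 0, by simp, by simp, fun t _ => by simp⟩
  | succ j ih =>
    obtain ⟨α, β, h1, h2, h3⟩ := ih
    refine ⟨((m : ℤ) - j : ℤ) * α, ((m : ℤ) - j : ℤ) * β - α, fun hj => ?_, fun hj => ?_,
      fun t ht => ?_⟩
    · refine mul_ne_zero ?_ (h1 (by omega))
      rw [Int.cast_ne_zero]; omega
    · rcases Nat.lt_or_ge m j with h | h
      · obtain ⟨ha, hb⟩ := h2 h
        refine ⟨by rw [ha, mul_zero], ?_⟩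
        rw [ha, sub_zero]
        refine mul_ne_zero ?_ hb
        rw [Int.cast_ne_zero]; omega
      · obtain rfl : m = j := by omega
        simpa using h1 le_rfl
    · rw [iteratedDeriv_succ]
      have he : iteratedDeriv j (fun s : ℝ => s ^ m * log (1 / s)) =ᶠ[𝓝 t]
          fun s => s ^ ((m : ℤ) - j) * (α * log (1 / s) + β) := by
        filter_upwards [lt_mem_nhds ht] with s hs using h3 s hs
      rw [he.deriv_eq, (hasDerivAt_zpow_mul_log_one_div _ α β ht).deriv]
      push_cast
      rw [sub_sub]

lemma tendsto_log_one_div_nhdsGT_zero :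
    Tendsto (fun t : ℝ => log (1 / t)) (𝓝[>] 0) atTop := by
  simp only [one_div]
  exact tendsto_log_atTop.comp tendsto_inv_nhdsGT_zero

lemma zpow_isBigO_iteratedDeriv_pow_mul_log (m n : ℕ) :
    (fun t : ℝ => t ^ ((m : ℤ) - n)) =O[𝓝[>] 0]
      iteratedDeriv n (fun s : ℝ => s ^ m * log (1 / s)) := by
  obtain ⟨α, β, h1, h2, h3⟩ := iteratedDeriv_pow_mul_log_one_div m n
  have hone : (fun _ : ℝ => (1 : ℝ)) =O[𝓝[>] 0] fun t : ℝ => α * log (1 / t) + β := by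
    rcases Nat.lt_or_ge m n with h | h
    · obtain ⟨ha, hb⟩ := h2 h
      simp only [ha, zero_mul, zero_add]
      exact isBigO_const_const _ hb _
    · have ha := h1 h
      have ht : Tendsto (fun t : ℝ => ‖α * log (1 / t) + β‖) (𝓝[>] 0) atTop := by
        rw [tendsto_norm_atTop_iff_cobounded]
        refine Tendsto.comp (g := fun x : ℝ => α * x + β) ?_ tendsto_log_one_div_nhdsGT_zero
        rw [← tendsto_norm_atTop_iff_cobounded]
        rcases lt_or_gt_of_ne ha with h | h
        · exact tendsto_abs_atBot_atTop.comp
            (tendsto_atBot_add_const_right _ _ (tendsto_id.const_mul_atTop_of_neg h))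
        · exact tendsto_norm_atTop_atTop.comp
            (tendsto_atTop_add_const_right _ _ (tendsto_id.const_mul_atTop h))
      refine IsBigO.of_bound 1 ?_
      filter_upwards [ht.eventually_ge_atTop 1] with t ht
      simpa using ht
  have h := (isBigO_refl (fun t : ℝ => t ^ ((m : ℤ) - n)) (𝓝[>] 0)).mul hone
  refine (h.congr' (by simp) ?_)
  filter_upwards [self_mem_nhdsWithin] with t ht using (h3 t ht).symm

lemma iteratedDeriv_pow_isBigO (m : ℕ) {j n : ℕ} (hj : j ≤ n) :
    iteratedDeriv j (fun s : ℝ => s ^ m) =O[𝓝[>] 0] fun t : ℝ => t ^ ((m : ℤ) - n) := by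
  have e : iteratedDeriv j (fun s : ℝ => s ^ m) = fun t : ℝ => (m.descFactorial j : ℝ) * t ^ (m - j) :=
    funext fun t => iteratedDeriv_pow m j
  rw [e]
  rcases Nat.lt_or_ge m j with h | h
  · simp [Nat.descFactorial_eq_zero_iff_lt.2 h, isBigO_zero]
  · refine IsBigO.const_mul_left (IsBigO.of_bound 1 ?_) _
    filter_upwards [Ioo_mem_nhdsGT (zero_lt_one' ℝ)] with t ht
    have e2 : t ^ (m - j) = t ^ ((m : ℤ) - n) * t ^ (n - j) := by
      rw [← zpow_natCast t (n - j), ← zpow_add₀ ht.1.ne', ← zpow_natCast t (m - j)]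
      congr 1
      omega
    rw [e2, norm_mul, one_mul, norm_pow, norm_of_nonneg ht.1.le]
    exact mul_le_of_le_one_right (norm_nonneg _) (pow_le_one₀ ht.1.le ht.2.le)

/-- For `j < n` the surplus factor `t ^ (n - j)` absorbs the logarithm, so the lower derivatives
occurring in Leibniz's rule are negligible. -/
lemma iteratedDeriv_pow_mul_log_isBigO (m : ℕ) {j n : ℕ} (hj : j ≤ n) :
    iteratedDeriv j (fun s : ℝ => s ^ m * log (1 / s)) =O[𝓝[>] 0]
      iteratedDeriv n (fun s : ℝ => s ^ m * log (1 / s)) := by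
  rcases hj.eq_or_lt with rfl | hlt
  · exact isBigO_refl _ _
  obtain ⟨α, β, -, -, h3⟩ := iteratedDeriv_pow_mul_log_one_div m j
  refine IsBigO.trans ?_ (zpow_isBigO_iteratedDeriv_pow_mul_log m n)
  have ht : Tendsto (fun t : ℝ => t ^ (n - j) * (α * log (1 / t) + β)) (𝓝[>] 0) (𝓝 0) := by
    have h1 : Tendsto (fun t : ℝ => log t * t) (𝓝[>] 0) (𝓝 0) := by
      simpa only [rpow_one] using tendsto_log_mul_rpow_nhdsGT_zero zero_lt_one
    have h0 : Tendsto (fun t : ℝ => t) (𝓝[>] 0) (𝓝 0) := nhdsWithin_le_nhds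
    have h2 := ((h0.pow (n - j - 1)).mul (((h1.const_mul (-α))).add (h0.mul_const β)))
    simp only [mul_zero, zero_mul, add_zero] at h2
    refine h2.congr fun t => ?_
    rw [one_div, log_inv, show n - j = n - j - 1 + 1 by omega, pow_succ]
    simp only [Nat.add_sub_cancel]
    ring
  have h := (isBigO_refl (fun t : ℝ => t ^ ((m : ℤ) - n)) (𝓝[>] 0)).mul (ht.isBigO_one ℝ)
  refine h.congr' ?_ (by simp)
  filter_upwards [self_mem_nhdsWithin] with t ht
  have ht0 : 0 < t := ht
  rw [h3 t ht, ← mul_assoc, ← zpow_natCast t (n - j), ← zpow_add₀ ht0.ne']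
  congr 2
  omega

lemma iteratedDeriv_isBigO_one_of_contDiffAt {A : ℝ → ℝ} (hA : ContDiffAt ℝ ∞ A 0) (i : ℕ) :
    iteratedDeriv i A =O[𝓝[>] 0] fun _ => (1 : ℝ) := by
  have h1 : ContDiffAt ℝ i A 0 := hA.of_le (by exact_mod_cast le_top)
  have h2 : ContinuousAt (iteratedDeriv i A) 0 := by
    have h3 := (h1.iteratedFDeriv_right (m := 0) (i := i) (by simp)).continuousAt
    rw [iteratedDeriv_eq_equiv_comp]
    exact (ContinuousMultilinearMap.piFieldEquiv ℝ (Fin i) ℝ).symm.continuous.continuousAt.comp h3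
  exact (h2.tendsto.mono_left nhdsWithin_le_nhds).isBigO_one ℝ

lemma iteratedDeriv_isBigO_of_eq_log_expansion {A B : ℝ → ℝ} (hA : ContDiffOn ℝ ∞ A (Ioo (-1) 1))
    (hB : ContDiffOn ℝ ∞ B (Ioo (-1) 1)) (m n : ℕ) :
    iteratedDeriv n (fun t => A t * (t ^ m * log (1 / t)) + B t * t ^ m) =O[𝓝[>] 0]
      iteratedDeriv n (fun s : ℝ => s ^ m * log (1 / s)) := by
  have hmem : ∀ t ∈ Ioo (0 : ℝ) 1, Ioo (-1 : ℝ) 1 ∈ 𝓝 t := fun t ht =>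
    Ioo_mem_nhds (by linarith [ht.1]) ht.2
  have h0 : Ioo (-1 : ℝ) 1 ∈ 𝓝 0 := Ioo_mem_nhds (by norm_num) (by norm_num)
  have e : (fun t => ∑ i ∈ Finset.range (n + 1), n.choose i * iteratedDeriv i A t
          * iteratedDeriv (n - i) (fun s : ℝ => s ^ m * log (1 / s)) t
        + ∑ i ∈ Finset.range (n + 1), n.choose i * iteratedDeriv i B t
          * iteratedDeriv (n - i) (fun s : ℝ => s ^ m) t)
      =ᶠ[𝓝[>] 0] iteratedDeriv n (fun t => A t * (t ^ m * log (1 / t)) + B t * t ^ m) := by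
    filter_upwards [Ioo_mem_nhdsGT (zero_lt_one' ℝ)] with t ht
    have hA' : ContDiffAt ℝ n A t :=
      (hA.contDiffAt (hmem t ht)).of_le (by exact_mod_cast le_top)
    have hB' : ContDiffAt ℝ n B t :=
      (hB.contDiffAt (hmem t ht)).of_le (by exact_mod_cast le_top)
    have hL : ContDiffAt ℝ n (fun s : ℝ => s ^ m * log (1 / s)) t := by
      simp only [one_div, log_inv]
      exact (contDiffAt_id.pow m).mul (contDiffAt_log.2 ht.1.ne').neg
    have hP : ContDiffAt ℝ n (fun s : ℝ => s ^ m) t := contDiffAt_id.pow m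
    rw [iteratedDeriv_fun_add (hA'.mul hL) (hB'.mul hP), iteratedDeriv_fun_mul hA' hL,
      iteratedDeriv_fun_mul hB' hP]
  refine IsBigO.congr' ?_ e EventuallyEq.rfl
  refine IsBigO.add (IsBigO.fun_sum fun i _ => ?_) (IsBigO.fun_sum fun i _ => ?_)
  · have h1 := (iteratedDeriv_isBigO_one_of_contDiffAt (hA.contDiffAt h0) i).const_mul_left
      (n.choose i : ℝ)
    simpa only [one_mul] using h1.mul (iteratedDeriv_pow_mul_log_isBigO m (Nat.sub_le n i))
  · have h1 := (iteratedDeriv_isBigO_one_of_contDiffAt (hB.contDiffAt h0) i).const_mul_left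
      (n.choose i : ℝ)
    simpa only [one_mul] using h1.mul ((iteratedDeriv_pow_isBigO m (Nat.sub_le n i)).trans
      (zpow_isBigO_iteratedDeriv_pow_mul_log m n))

/-! ### The law of the two-dimensional band energy -/

lemma setLIntegral_Ioc_comp_add_of_periodic {f : ℝ → ℝ≥0∞} (hf : Function.Periodic f (2 * π))
    (a : ℝ) : ∫⁻ x in Ioc (-π) π, f (x + a) = ∫⁻ x in Ioc (-π) π, f x := by
  have h1 : ∫⁻ x in Ioc (-π) π, f (x + a) = ∫⁻ x in Ioc (-π + a) (π + a), f x := by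
    rw [← lintegral_indicator measurableSet_Ioc, ← lintegral_indicator measurableSet_Ioc,
      ← lintegral_add_right_eq_self ((Ioc (-π + a) (π + a)).indicator fun x => f x) a]
    refine lintegral_congr fun x => ?_
    simp only [indicator, mem_Ioc, add_lt_add_iff_right, add_le_add_iff_right]
  rw [h1]
  have d1 := isAddFundamentalDomain_Ioc two_pi_pos (-π)
  have d2 := isAddFundamentalDomain_Ioc two_pi_pos (-π + a)
  rw [show -π + 2 * π = π by ring] at d1
  rw [show -π + a + 2 * π = π + a by ring] at d2
  refine d2.setLIntegral_eq d1 f fun g x => ?_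
  obtain ⟨g, n, rfl⟩ := g
  simpa [AddSubgroup.vadd_def, add_comm] using hf.int_mul n x

/-- Periodicity allows the shifts `x ↦ x + y` and then `y ↦ y - x / 2`, after which the sum is `cos
(y + x / 2) + cos (y - x / 2)`. Separating the variables in this way reduces the planar energy to
the arcsine law. -/
lemma setLIntegral_Ioc_cos_add_cos {g : ℝ → ℝ≥0∞} (hg : Measurable g) :
    ∫⁻ x in Ioc (-π) π, ∫⁻ y in Ioc (-π) π, g (cos x + cos y)
      = ∫⁻ x in Ioc (-π) π, ∫⁻ y in Ioc (-π) π, g (2 * cos (x / 2) * cos y) := by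
  have h1 : ∀ y, ∫⁻ x in Ioc (-π) π, g (cos x + cos y)
      = ∫⁻ x in Ioc (-π) π, g (cos (x + y) + cos y) := fun y =>
    (setLIntegral_Ioc_comp_add_of_periodic (f := fun x => g (cos x + cos y))
      (fun x => by simp) y).symm
  have h2 : ∀ x, ∫⁻ y in Ioc (-π) π, g (cos (x + y) + cos y)
      = ∫⁻ y in Ioc (-π) π, g (2 * cos (x / 2) * cos y) := fun x => by
    rw [← setLIntegral_Ioc_comp_add_of_periodic (f := fun y => g (cos (x + y) + cos y))
      (fun y => by simp [← add_assoc]) (-(x / 2))]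
    refine lintegral_congr fun y => ?_
    congr 1
    rw [show x + (y + -(x / 2)) = y + x / 2 by ring, cos_add, ← sub_eq_add_neg, cos_sub]
    ring
  rw [lintegral_lintegral_swap (by fun_prop)]
  simp only [h1]
  rw [lintegral_lintegral_swap (by fun_prop)]
  simp only [h2]

lemma setLIntegral_Ioc_of_even {f : ℝ → ℝ≥0∞} (hf : ∀ x, f (-x) = f x) :
    ∫⁻ x in Ioc (-π) π, f x = 2 * ∫⁻ x in Ioo 0 π, f x := by
  have hneg : ∫⁻ x in Ioo (-π) 0, f x = ∫⁻ x in Ioo 0 π, f x := by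
    rw [← lintegral_indicator measurableSet_Ioo, ← lintegral_indicator measurableSet_Ioo,
      ← lintegral_neg_eq_self]
    refine lintegral_congr fun x => ?_
    simp only [indicator, mem_Ioo, hf]
    congr 1
    rw [eq_iff_iff]
    constructor <;> rintro ⟨h1, h2⟩ <;> constructor <;> linarith
  rw [← Ioc_union_Ioc_eq_Ioc (b := 0) (by linarith [pi_pos]) pi_pos.le,
    lintegral_union measurableSet_Ioc (Ioc_disjoint_Ioc_of_le le_rfl),
    ← setLIntegral_congr Ioo_ae_eq_Ioc, ← setLIntegral_congr Ioo_ae_eq_Ioc, hneg, two_mul]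

lemma setLIntegral_Ioc_comp_neg_mul_cos {a : ℝ} (ha : 0 < a) (f : ℝ → ℝ≥0∞) :
    ∫⁻ q in Ioc (-π) π, f (-a * cos q) = ∫⁻ y, f y * ENNReal.ofReal (2 / √(a ^ 2 - y ^ 2)) := by
  have hpi := pi_pos
  have himg : (fun q => -a * cos q) '' Ioo 0 π = Ioo (-a) a := by
    ext y
    constructor
    · rintro ⟨q, hq, rfl⟩
      have h1 : cos q < 1 := by
        rw [← cos_zero]
        exact cos_lt_cos_of_nonneg_of_le_pi le_rfl hq.2.le hq.1
      have h2 : -1 < cos q := by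
        rw [← cos_pi]
        exact cos_lt_cos_of_nonneg_of_le_pi hq.1.le le_rfl hq.2
      exact ⟨by nlinarith, by nlinarith⟩
    · rintro ⟨h1, h2⟩
      have h3 : -1 < -y / a := by rw [lt_div_iff₀ ha]; linarith
      have h4 : -y / a < 1 := by rw [div_lt_iff₀ ha]; linarith
      refine ⟨arccos (-y / a), ⟨arccos_pos.2 h4, ?_⟩, ?_⟩
      · refine lt_of_le_of_ne (arccos_le_pi _) fun h => ?_
        rw [arccos_eq_pi] at h
        linarith
      · simp only [cos_arccos h3.le h4.le]
        field_simp
  have hinj : InjOn (fun q => -a * cos q) (Ioo 0 π) := fun x hx y hy hxy =>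
    injOn_cos ⟨hx.1.le, hx.2.le⟩ ⟨hy.1.le, hy.2.le⟩
      (mul_left_cancel₀ (neg_ne_zero.2 ha.ne') hxy)
  have hhalf : ∫⁻ q in Ioo 0 π, f (-a * cos q)
      = ∫⁻ y in Ioo (-a) a, f y * ENNReal.ofReal (1 / √(a ^ 2 - y ^ 2)) := by
    rw [← himg, lintegral_image_eq_lintegral_abs_deriv_mul measurableSet_Ioo
      (f' := fun q => a * sin q) (fun q _ => ?_) hinj]
    · refine setLIntegral_congr_fun measurableSet_Ioo fun q hq => ?_
      have hs : 0 < sin q := sin_pos_of_mem_Ioo hq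
      have e : √(a ^ 2 - (-a * cos q) ^ 2) = a * sin q := by
        rw [show a ^ 2 - (-a * cos q) ^ 2 = (a * sin q) ^ 2 by
          rw [mul_pow, mul_pow, sin_sq]; ring,
          sqrt_sq (by positivity)]
      simp only [e]
      rw [abs_of_pos (by positivity), mul_left_comm, ← ENNReal.ofReal_mul (by positivity),
        mul_one_div_cancel (by positivity), ENNReal.ofReal_one, mul_one]
    · simpa using ((hasDerivAt_cos q).const_mul (-a)).hasDerivWithinAt
  have hsplit : ∫⁻ q in Ioc (-π) π, f (-a * cos q) = 2 * ∫⁻ q in Ioo 0 π, f (-a * cos q) :=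
    setLIntegral_Ioc_of_even fun q => by rw [cos_neg]
  -- Outside `(-a, a)` the square root of a nonpositive number is `0` and division by it gives `0`,
  -- so the density needs no indicator.
  have hsupp : ∫⁻ y, f y * ENNReal.ofReal (2 / √(a ^ 2 - y ^ 2))
      = ∫⁻ y in Ioo (-a) a, f y * ENNReal.ofReal (2 / √(a ^ 2 - y ^ 2)) := by
    rw [← lintegral_indicator measurableSet_Ioo]
    refine lintegral_congr fun y => ?_
    by_cases hy : y ∈ Ioo (-a) a
    · rw [indicator_of_mem hy]
    · rw [indicator_of_notMem hy]
      have h : a ^ 2 - y ^ 2 ≤ 0 := by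
        rw [mem_Ioo, not_and_or, not_lt, not_lt] at hy
        rcases hy with h | h <;> nlinarith
      simp [sqrt_eq_zero_of_nonpos h]
  rw [hsplit, hhalf, hsupp, ← lintegral_const_mul' _ _ (by simp)]
  refine lintegral_congr fun y => ?_
  rw [mul_left_comm, show (2 : ℝ) / √(a ^ 2 - y ^ 2) = 2 * (1 / √(a ^ 2 - y ^ 2)) by ring,
    ENNReal.ofReal_mul zero_le_two]
  simp

/-- The density, with respect to Lebesgue measure, of the energy `-2 (cos k₁ + cos k₂)` on the
square `[-π, π]²`. -/
noncomputable def planarWeight (y : ℝ) : ℝ≥0∞ :=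
  ∫⁻ x in Ioc (-π) π, ENNReal.ofReal (2 / √((4 * cos (x / 2)) ^ 2 - y ^ 2))

lemma measurable_planarWeight : Measurable planarWeight := by
  unfold planarWeight
  refine Measurable.lintegral_prod_right'
    (f := fun p : ℝ × ℝ => ENNReal.ofReal (2 / √((4 * cos (p.2 / 2)) ^ 2 - p.1 ^ 2))) ?_
  fun_prop

lemma setLIntegral_planarEnergy {f : ℝ → ℝ≥0∞} (hf : Measurable f) :
    ∫⁻ x in Ioc (-π) π, ∫⁻ y in Ioc (-π) π, f (-2 * (cos x + cos y))
      = ∫⁻ y, f y * planarWeight y := by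
  rw [setLIntegral_Ioc_cos_add_cos (g := fun s => f (-2 * s)) (by fun_prop)]
  have h : ∀ x ∈ Ioo (-π) π, ∫⁻ y in Ioc (-π) π, f (-2 * (2 * cos (x / 2) * cos y))
      = ∫⁻ y, f y * ENNReal.ofReal (2 / √((4 * cos (x / 2)) ^ 2 - y ^ 2)) := fun x hx => by
    have hc : 0 < cos (x / 2) := cos_pos_of_mem_Ioo ⟨by linarith [hx.1], by linarith [hx.2]⟩
    rw [← setLIntegral_Ioc_comp_neg_mul_cos (by positivity)]
    refine lintegral_congr fun y => ?_
    congr 1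
    ring
  rw [← setLIntegral_congr Ioo_ae_eq_Ioc, setLIntegral_congr_fun measurableSet_Ioo h,
    setLIntegral_congr Ioo_ae_eq_Ioc, lintegral_lintegral_swap (by fun_prop)]
  refine lintegral_congr fun y => ?_
  rw [planarWeight, lintegral_const_mul _ (by fun_prop)]

lemma cos_sq_add_mul_sin_sq_pos {c : ℝ} (hc : c ≠ 0) (φ : ℝ) :
    0 < cos φ ^ 2 + c ^ 2 * sin φ ^ 2 := by
  rcases eq_or_ne (cos φ) 0 with h | h
  · have h1 := sin_sq_add_cos_sq φ
    rw [h] at h1 ⊢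
    have h2 : sin φ ^ 2 = 1 := by linarith
    rw [h2]
    positivity
  · positivity

lemma continuous_ellipticKPrime_integrand {c : ℝ} (hc : c ≠ 0) :
    Continuous fun φ => 1 / √(cos φ ^ 2 + c ^ 2 * sin φ ^ 2) :=
  Continuous.div (by fun_prop) (by fun_prop) fun φ =>
    (sqrt_pos.2 (cos_sq_add_mul_sin_sq_pos hc φ)).ne'

lemma ellipticKPrime_nonneg (c : ℝ) : 0 ≤ ellipticKPrime c :=
  intervalIntegral.integral_nonneg (by positivity) fun φ _ => by positivity

lemma setLIntegral_Ioo_ellipticKPrime_integrand {c : ℝ} (hc : c ≠ 0) :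
    ∫⁻ φ in Ioo (-(π / 2)) (π / 2), ENNReal.ofReal (1 / √(cos φ ^ 2 + c ^ 2 * sin φ ^ 2))
      = ENNReal.ofReal (2 * ellipticKPrime c) := by
  have hcont := continuous_ellipticKPrime_integrand hc
  rw [← ofReal_integral_eq_lintegral_ofReal
      (hcont.integrableOn_Ioc.mono_set Ioo_subset_Ioc_self)
      (ae_of_all _ fun φ => by positivity),
    ← integral_Ioc_eq_integral_Ioo, ← intervalIntegral.integral_of_le (by linarith [pi_pos]),
    ← intervalIntegral.integral_add_adjacent_intervals (b := 0)
      (hcont.intervalIntegrable _ _) (hcont.intervalIntegrable _ _)]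
  have h := intervalIntegral.integral_comp_neg (a := 0) (b := π / 2)
    (fun φ => 1 / √(cos φ ^ 2 + c ^ 2 * sin φ ^ 2))
  simp only [cos_neg, sin_neg, neg_sq, neg_zero] at h
  rw [← h, ← ellipticKPrime, two_mul]

/-- The substitution `sin (x / 2) = r sin φ` with `r² = 1 - (y / 4)²`: the denominator becomes `4 r
cos φ`, which cancels against the Jacobian and leaves the elliptic integrand. The set `S` is where
the radicand is positive; off `S` the integrand is zero. -/
lemma planarWeight_eq {y : ℝ} (h0 : y ≠ 0) (h4 : |y| < 4) :
    planarWeight y = ENNReal.ofReal (2 * ellipticKPrime (y / 4)) := by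
  set c := y / 4 with hc
  have hy : y = 4 * c := by rw [hc]; ring
  have hc0 : c ≠ 0 := by simpa [hc] using h0
  have hc1 : c ^ 2 < 1 := by
    rw [sq_lt_one_iff_abs_lt_one, hc, abs_div, abs_of_pos (by norm_num : (0 : ℝ) < 4)]
    linarith
  set r := √(1 - c ^ 2) with hr
  have hr0 : 0 < r := sqrt_pos.2 (by linarith)
  have hr2 : r ^ 2 = 1 - c ^ 2 := sq_sqrt (by linarith)
  have hr1 : r < 1 := by
    have : 0 < c ^ 2 := by positivity
    nlinarith
  have hrs : ∀ φ, -1 < r * sin φ ∧ r * sin φ < 1 := fun φ =>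
    ⟨by nlinarith [neg_one_le_sin φ], by nlinarith [sin_le_one φ]⟩
  set F : ℝ → ℝ≥0∞ := fun x => ENNReal.ofReal (2 / √((4 * cos (x / 2)) ^ 2 - y ^ 2)) with hF
  set S : Set ℝ := {x | |sin (x / 2)| < r} with hS
  have hSm : MeasurableSet S := measurableSet_lt (by fun_prop) measurable_const
  have himg : (fun φ => 2 * arcsin (r * sin φ)) '' Ioo (-(π / 2)) (π / 2) = Ioo (-π) π ∩ S := by
    ext x
    constructor
    · rintro ⟨φ, hφ, rfl⟩
      have h1 := neg_pi_div_two_lt_arcsin.2 (hrs φ).1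
      have h2 := arcsin_lt_pi_div_two.2 (hrs φ).2
      refine ⟨⟨by linarith, by linarith⟩, ?_⟩
      have h3 : |sin φ| < 1 := by
        rw [← sq_lt_one_iff_abs_lt_one, sin_sq]
        have := cos_pos_of_mem_Ioo hφ
        have : 0 < cos φ ^ 2 := by positivity
        linarith
      simp only [hS, mem_ofPred_eq, mul_div_cancel_left₀ _ (two_ne_zero' ℝ),
        sin_arcsin (hrs φ).1.le (hrs φ).2.le, abs_mul, abs_of_pos hr0]
      nlinarith
    · rintro ⟨hx, hxS⟩
      simp only [hS, mem_ofPred_eq, abs_lt] at hxS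
      have h3 : -1 < sin (x / 2) / r := by rw [lt_div_iff₀ hr0]; linarith [hxS.1]
      have h4 : sin (x / 2) / r < 1 := by rw [div_lt_iff₀ hr0]; linarith [hxS.2]
      refine ⟨arcsin (sin (x / 2) / r), ⟨neg_pi_div_two_lt_arcsin.2 h3,
        arcsin_lt_pi_div_two.2 h4⟩, ?_⟩
      simp only [sin_arcsin h3.le h4.le, mul_div_cancel₀ _ hr0.ne']
      rw [arcsin_sin (by linarith [hx.1]) (by linarith [hx.2])]
      ring
  have hinj : InjOn (fun φ => 2 * arcsin (r * sin φ)) (Ioo (-(π / 2)) (π / 2)) :=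
    fun a ha b hb hab => by
      have h1 := mul_left_cancel₀ two_ne_zero hab
      rw [arcsin_inj (hrs a).1.le (hrs a).2.le (hrs b).1.le (hrs b).2.le] at h1
      exact injOn_sin ⟨ha.1.le, ha.2.le⟩ ⟨hb.1.le, hb.2.le⟩ (mul_left_cancel₀ hr0.ne' h1)
  have hsupp : ∫⁻ x in Ioo (-π) π ∩ S, F x = planarWeight y := by
    have h := lintegral_inter_add_sdiff (μ := volume) F (Ioo (-π) π) hSm
    have hz : ∫⁻ x in Ioo (-π) π \ S, F x = 0 := by
      rw [setLIntegral_congr_fun (measurableSet_Ioo.diff hSm) (g := fun _ => 0)]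
      · simp
      · rintro x ⟨-, hx⟩
        simp only [hS, mem_ofPred_eq, not_lt] at hx
        have h1 : r ^ 2 ≤ sin (x / 2) ^ 2 := by
          rw [← sq_abs (sin (x / 2))]
          exact pow_le_pow_left₀ hr0.le hx 2
        have h2 : (4 * cos (x / 2)) ^ 2 - y ^ 2 ≤ 0 := by
          rw [hy, mul_pow, mul_pow, cos_sq']; nlinarith
        simp [hF, sqrt_eq_zero_of_nonpos h2]
    rw [hz, add_zero] at h
    rw [h, planarWeight, setLIntegral_congr Ioo_ae_eq_Ioc]
  rw [← hsupp, ← himg, lintegral_image_eq_lintegral_abs_deriv_mul measurableSet_Ioo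
    (f' := fun φ => 2 * (1 / √(1 - (r * sin φ) ^ 2) * (r * cos φ))) (fun φ _ => ?_) hinj,
    ← setLIntegral_Ioo_ellipticKPrime_integrand hc0]
  · refine setLIntegral_congr_fun measurableSet_Ioo fun φ hφ => ?_
    have hcos := cos_pos_of_mem_Ioo hφ
    have hpos := cos_sq_add_mul_sin_sq_pos hc0 φ
    have e1 : 1 - (r * sin φ) ^ 2 = cos φ ^ 2 + c ^ 2 * sin φ ^ 2 := by
      rw [mul_pow, hr2, cos_sq']; ring
    have e2 : (4 * cos (2 * arcsin (r * sin φ) / 2)) ^ 2 - y ^ 2 = (4 * (r * cos φ)) ^ 2 := by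
      rw [mul_div_cancel_left₀ _ (two_ne_zero' ℝ), mul_pow, cos_sq',
        sin_arcsin (hrs φ).1.le (hrs φ).2.le, hy, mul_pow, mul_pow, mul_pow, mul_pow, hr2, sin_sq]
      ring
    simp only [hF]
    rw [e1, e2, sqrt_sq (by positivity)]
    have hq := sqrt_pos.2 hpos
    rw [abs_of_pos (by positivity), ← ENNReal.ofReal_mul (by positivity)]
    congr 1
    field_simp
    norm_num
  · have h := (hasDerivAt_arcsin (hrs φ).1.ne' (hrs φ).2.ne).comp φ
      ((hasDerivAt_sin φ).const_mul r)
    exact (h.const_mul 2).hasDerivWithinAt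

/-! ### The volume of the sublevel sets of the band relation -/

/-- The density, with respect to Lebesgue measure, of the band energy on the Brillouin zone. -/
noncomputable def bandWeight (tz y : ℝ) : ℝ≥0∞ :=
  ∫⁻ θ in Ioc (-π) π, planarWeight (y + 2 * tz * cos θ)

lemma measurableSet_sublevel (tz E : ℝ) :
    MeasurableSet {k : ℝ × ℝ × ℝ | k ∈ brillouinZone ∧ bandRelation tz k ≤ E} := by
  have h1 : Measurable (bandRelation tz) := by unfold bandRelation; fun_prop
  exact (measurableSet_Icc.prod (measurableSet_Icc.prod measurableSet_Icc)).inter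
    (h1 measurableSet_Iic)

/-- Tonelli, the law of the planar energy, and a translation by `2 tz cos z` that moves the shift
from the threshold onto `planarWeight`. -/
lemma volume_sublevel_eq (tz E : ℝ) :
    volume {k : ℝ × ℝ × ℝ | k ∈ brillouinZone ∧ bandRelation tz k ≤ E}
      = ∫⁻ y in Iic E, bandWeight tz y := by
  set g : ℝ → ℝ≥0∞ := (Iic E).indicator 1 with hg
  have hgm : Measurable g := measurable_one.indicator measurableSet_Iic
  have hW := measurable_planarWeight
  have h1 : volume {k : ℝ × ℝ × ℝ | k ∈ brillouinZone ∧ bandRelation tz k ≤ E}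
      = ∫⁻ x in Icc (-π) π, ∫⁻ y in Icc (-π) π, ∫⁻ z in Icc (-π) π,
          g (-2 * (cos x + cos y) - 2 * tz * cos z) := by
    rw [← lintegral_indicator_one (measurableSet_sublevel tz E), Measure.volume_eq_prod,
      lintegral_prod _ ((measurable_one.indicator (measurableSet_sublevel tz E)).aemeasurable),
      ← lintegral_indicator measurableSet_Icc]
    refine lintegral_congr fun x => ?_
    rw [Measure.volume_eq_prod, lintegral_prod _ (by
      exact ((measurable_one.indicator (measurableSet_sublevel tz E)).comp
        measurable_prodMk_left).aemeasurable)]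
    by_cases hx : x ∈ Icc (-π) π
    · rw [indicator_of_mem hx, ← lintegral_indicator measurableSet_Icc]
      refine lintegral_congr fun y => ?_
      by_cases hy : y ∈ Icc (-π) π
      · rw [indicator_of_mem hy, ← lintegral_indicator measurableSet_Icc]
        refine lintegral_congr fun z => ?_
        by_cases hz : z ∈ Icc (-π) π
        · rw [indicator_of_mem hz]
          simp only [hg, indicator, mem_ofPred_eq, brillouinZone, mem_prod, hx, hy, hz,
            bandRelation, mem_Iic, true_and, and_self,
            Pi.one_apply]
        · rw [indicator_of_notMem hz, indicator_of_notMem]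
          exact fun h => hz h.1.2.2
      · rw [indicator_of_notMem hy]
        have : ∀ z : ℝ, ({k : ℝ × ℝ × ℝ | k ∈ brillouinZone ∧ bandRelation tz k ≤ E}).indicator
            (1 : ℝ × ℝ × ℝ → ℝ≥0∞) (x, y, z) = 0 := fun z =>
          indicator_of_notMem (fun h => hy h.1.2.1) _
        simp [this]
    · rw [indicator_of_notMem hx]
      have : ∀ y z : ℝ, ({k : ℝ × ℝ × ℝ | k ∈ brillouinZone ∧ bandRelation tz k ≤ E}).indicator
          (1 : ℝ × ℝ × ℝ → ℝ≥0∞) (x, y, z) = 0 := fun y z =>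
        indicator_of_notMem (fun h => hx h.1.1) _
      simp [this]
  have h2 : ∀ f : ℝ → ℝ≥0∞, ∫⁻ x in Icc (-π) π, f x = ∫⁻ x in Ioc (-π) π, f x := fun f =>
    (setLIntegral_congr Ioc_ae_eq_Icc).symm
  simp only [h1, h2]
  have hf : Measurable fun s => ∫⁻ z in Ioc (-π) π, g (s - 2 * tz * cos z) :=
    Measurable.lintegral_prod_right'
      (f := fun p : ℝ × ℝ => g (p.1 - 2 * tz * cos p.2)) (by fun_prop)
  rw [setLIntegral_planarEnergy hf]
  have h4 : ∀ y, (∫⁻ z in Ioc (-π) π, g (y - 2 * tz * cos z)) * planarWeight y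
      = ∫⁻ z in Ioc (-π) π, g (y - 2 * tz * cos z) * planarWeight y := fun y =>
    (lintegral_mul_const _ (by fun_prop)).symm
  simp only [h4]
  rw [lintegral_lintegral_swap (by fun_prop)]
  have h3 : ∀ z, ∫⁻ y, g (y - 2 * tz * cos z) * planarWeight y
      = ∫⁻ y, g y * planarWeight (y + 2 * tz * cos z) := fun z => by
    rw [← lintegral_add_right_eq_self _ (2 * tz * cos z)]
    simp
  simp only [h3]
  rw [lintegral_lintegral_swap (by fun_prop), ← lintegral_indicator measurableSet_Iic]
  refine lintegral_congr fun y => ?_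
  rw [lintegral_const_mul _ (by fun_prop)]
  by_cases hy : y ∈ Iic E
  · simp only [hg, indicator_of_mem hy, Pi.one_apply, one_mul, bandWeight]
  · simp only [hg, indicator_of_notMem hy, zero_mul]

/-! ### Continuity of the density of states in the energy -/

lemma ellipticKPrime_neg (c : ℝ) : ellipticKPrime (-c) = ellipticKPrime c := by
  simp [ellipticKPrime]

lemma continuousAt_ellipticKPrime {c : ℝ} (hc : 0 < c) : ContinuousAt ellipticKPrime c := by
  have hpos : ∀ x : ℝ, 0 < max x (c / 2) := fun x => lt_max_of_lt_right (by positivity)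
  -- Truncating the parameter below at `c / 2` gives a jointly continuous integrand without changing
  -- it near `c`.
  have h : Continuous fun x : ℝ => ∫ φ in (0 : ℝ)..(π / 2),
      1 / √(cos φ ^ 2 + max x (c / 2) ^ 2 * sin φ ^ 2) := by
    refine intervalIntegral.continuous_parametric_intervalIntegral_of_continuous' ?_ _ _
    refine Continuous.div (by fun_prop) (by fun_prop) fun p => ?_
    exact (sqrt_pos.2 (cos_sq_add_mul_sin_sq_pos (hpos p.1).ne' p.2)).ne'
  refine h.continuousAt.congr ?_
  filter_upwards [lt_mem_nhds (half_lt_self hc)] with x hx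
  rw [max_eq_left hx.le, ellipticKPrime]

lemma measurable_ellipticKPrime : Measurable ellipticKPrime := by
  have h : StronglyMeasurable fun c : ℝ =>
      ∫ φ in Ioc 0 (π / 2), 1 / √(cos φ ^ 2 + c ^ 2 * sin φ ^ 2) :=
    StronglyMeasurable.integral_prod_right'
      (f := fun p : ℝ × ℝ => 1 / √(cos p.2 ^ 2 + p.1 ^ 2 * sin p.2 ^ 2))
      (Measurable.stronglyMeasurable (by fun_prop))
  have e : ellipticKPrime = fun c : ℝ =>
      ∫ φ in Ioc 0 (π / 2), 1 / √(cos φ ^ 2 + c ^ 2 * sin φ ^ 2) :=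
    funext fun c => intervalIntegral.integral_of_le (by positivity)
  rw [e]
  exact h.measurable

/-- Each term of the series is at most `c ^ (2 n) (log (1 / c) + 2)`, and the geometric series sums
to at most `2`. -/
lemma ellipticKPrime_le {c : ℝ} (h0 : 0 < c) (h1 : c ≤ 1 / 2) :
    ellipticKPrime c ≤ 2 * (log (1 / c) + 2) := by
  have hL : 0 ≤ log (1 / c) := log_nonneg (by rw [le_div_iff₀ h0]; linarith)
  have hc2 : c ^ 2 ≤ 1 / 4 := by nlinarith
  have hg := (hasSum_geometric_of_lt_one (sq_nonneg c) (by linarith)).mul_right (log (1 / c) + 2)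
  have h := hasSum_le (fun n => ?_) (hasSum_ellipticKPrime ⟨h0, by linarith⟩) hg
  · refine h.trans (mul_le_mul_of_nonneg_right ?_ (by positivity))
    exact (inv_le_comm₀ (by linarith) two_pos).2 (by linarith)
  · rw [← pow_mul]
    have hm := (le_abs_self _).trans (abs_cosMoment_pow_le_one n 2)
    have hm0 : 0 ≤ cosMoment n ^ 2 := sq_nonneg _
    refine mul_le_mul_of_nonneg_left (add_le_add ?_ ?_) (by positivity)
    · exact mul_le_of_le_one_left hL hm
    · have := mul_le_one₀ hm (altHarmonicTail_nonneg n) (altHarmonicTail_le_one n)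
      linarith

/-- Transversality at the level `θ = τ`. In the product formula one sine has its argument between `π
/ 6` and `5 π / 6`, hence is at least `1 / 2`; Jordan's inequality bounds the other from below. -/
lemma one_sub_div_three_le_cos_sub_cos {τ u : ℝ} (hτ : τ ∈ Ioo (π / 3) (2 * π / 3))
    (hu : u ∈ Ioc (0 : ℝ) 1) : (1 - u) / 3 ≤ cos (τ * u) - cos τ := by
  obtain ⟨h1, h2⟩ := hτ
  obtain ⟨hu0, hu1⟩ := hu
  have hpi := pi_pos
  have hτ0 : 0 < τ := by linarith [div_pos hpi three_pos]
  have e : cos (τ * u) - cos τ = 2 * sin (τ * (1 + u) / 2) * sin (τ * (1 - u) / 2) := by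
    rw [cos_sub_cos, show (τ * u - τ) / 2 = -(τ * (1 - u) / 2) by ring, sin_neg,
      show (τ * u + τ) / 2 = τ * (1 + u) / 2 by ring]
    ring
  have hs1 : 1 / 2 ≤ sin (τ * (1 + u) / 2) := by
    rcases le_total (τ * (1 + u) / 2) (π / 2) with h | h
    · rw [← sin_pi_div_six]
      exact sin_le_sin_of_le_of_le_pi_div_two (by linarith) h (by nlinarith)
    · rw [← sin_pi_div_six, ← sin_pi_sub (τ * (1 + u) / 2)]
      exact sin_le_sin_of_le_of_le_pi_div_two (by linarith) (by linarith) (by nlinarith)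
  have hs2 : 2 / π * (τ * (1 - u) / 2) ≤ sin (τ * (1 - u) / 2) :=
    mul_le_sin (by nlinarith) (by nlinarith)
  have hs3 : (1 - u) / 3 ≤ 2 / π * (τ * (1 - u) / 2) := by
    have : 2 / π * (τ * (1 - u) / 2) = τ / π * (1 - u) := by field_simp
    rw [this]
    have h3 : 1 / 3 ≤ τ / π := by rw [le_div_iff₀ hpi]; linarith
    nlinarith
  rw [e]
  nlinarith

/-- The contribution to the density of states of the momenta on one side of the level set. -/
noncomputable def levelIntegral (a τ : ℝ) : ℝ :=
  ∫ θ in (0 : ℝ)..τ, ellipticKPrime (a * (cos θ - cos τ))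

lemma intervalIntegrable_log_one_sub :
    IntervalIntegrable (fun u : ℝ => log (1 - u)) volume 0 1 := by
  have h := (intervalIntegral.intervalIntegrable_log' (a := 0) (b := 1)).comp_sub_left 1
  simpa using h.symm

lemma ellipticKPrime_levelIntegrand_le {a τ u : ℝ} (ha : a ∈ Ioo (0 : ℝ) (1 / 4))
    (hτ : τ ∈ Ioo (π / 3) (2 * π / 3)) (hu : u ∈ Ioo (0 : ℝ) 1) :
    ‖ellipticKPrime (a * (cos (τ * u) - cos τ))‖ ≤ 2 * (log (3 / a) - log (1 - u) + 2) := by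
  have h1 := one_sub_div_three_le_cos_sub_cos hτ ⟨hu.1, hu.2.le⟩
  have ha0 := ha.1
  have hu1 : 0 < 1 - u := by linarith [hu.2]
  have hx : a * ((1 - u) / 3) ≤ a * (cos (τ * u) - cos τ) := by gcongr
  have hx0 : 0 < a * (cos (τ * u) - cos τ) := lt_of_lt_of_le (by positivity) hx
  have hx1 : a * (cos (τ * u) - cos τ) ≤ 1 / 2 := by
    nlinarith [cos_le_one (τ * u), neg_one_le_cos τ, ha.2]
  rw [norm_of_nonneg (ellipticKPrime_nonneg _)]
  refine (ellipticKPrime_le hx0 hx1).trans ?_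
  have e : log (3 / a) - log (1 - u) = log (1 / (a * ((1 - u) / 3))) := by
    rw [← log_div (by positivity) hu1.ne']
    congr 1
    field_simp
  rw [e]
  gcongr

lemma intervalIntegrable_levelBound (a : ℝ) :
    IntervalIntegrable (fun u : ℝ => 2 * (log (3 / a) - log (1 - u) + 2)) volume 0 1 :=
  ((intervalIntegrable_const.sub intervalIntegrable_log_one_sub).add
    intervalIntegrable_const).const_mul 2

/-- Rescaling to `[0, 1]` pins the logarithmic singularity at `u = 1`, so one integrable bound
serves all nearby `τ`. -/
lemma levelIntegral_eq {a τ : ℝ} :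
    levelIntegral a τ = τ * ∫ u in (0 : ℝ)..1, ellipticKPrime (a * (cos (τ * u) - cos τ)) := by
  rw [levelIntegral, intervalIntegral.mul_integral_comp_mul_left
    (f := fun θ => ellipticKPrime (a * (cos θ - cos τ)))]
  simp

lemma ae_mem_Ioo_of_mem_uIoc : ∀ᵐ u : ℝ, u ∈ uIoc (0 : ℝ) 1 → u ∈ Ioo (0 : ℝ) 1 := by
  filter_upwards [(countable_singleton (1 : ℝ)).ae_notMem volume] with u hne hu
  rw [uIoc_of_le zero_le_one] at hu
  exact ⟨hu.1, lt_of_le_of_ne hu.2 hne⟩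

lemma continuousAt_levelIntegral {a τ : ℝ} (ha : a ∈ Ioo (0 : ℝ) (1 / 4))
    (hτ : τ ∈ Ioo (π / 3) (2 * π / 3)) : ContinuousAt (levelIntegral a) τ := by
  have hm := measurable_ellipticKPrime
  have h : ContinuousAt
      (fun τ => ∫ u in (0 : ℝ)..1, ellipticKPrime (a * (cos (τ * u) - cos τ))) τ := by
    refine intervalIntegral.continuousAt_of_dominated_interval
      (bound := fun u => 2 * (log (3 / a) - log (1 - u) + 2))
      (Eventually.of_forall fun x => Measurable.aestronglyMeasurable (by fun_prop)) ?_
      (intervalIntegrable_levelBound a) ?_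
    · filter_upwards [Ioo_mem_nhds hτ.1 hτ.2] with x hx
      filter_upwards [ae_mem_Ioo_of_mem_uIoc] with u hu hu'
      exact ellipticKPrime_levelIntegrand_le ha hx (hu hu')
    · filter_upwards [ae_mem_Ioo_of_mem_uIoc] with u hu hu'
      have hu := hu hu'
      have h1 := one_sub_div_three_le_cos_sub_cos hτ ⟨hu.1, hu.2.le⟩
      have hx0 : 0 < a * (cos (τ * u) - cos τ) :=
        mul_pos ha.1 (lt_of_lt_of_le (by linarith [hu.2]) h1)
      exact ContinuousAt.comp (f := fun x => a * (cos (x * u) - cos x))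
        (continuousAt_ellipticKPrime hx0) (by fun_prop)
  have e : levelIntegral a
      = fun τ => τ * ∫ u in (0 : ℝ)..1, ellipticKPrime (a * (cos (τ * u) - cos τ)) :=
    funext fun τ => levelIntegral_eq
  rw [e]
  exact continuousAt_id.mul h

lemma levelIntegral_nonneg {a τ : ℝ} (hτ : 0 ≤ τ) : 0 ≤ levelIntegral a τ :=
  intervalIntegral.integral_nonneg hτ fun _ _ => ellipticKPrime_nonneg _

lemma setLIntegral_levelIntegrand {a τ : ℝ} (ha : a ∈ Ioo (0 : ℝ) (1 / 4))
    (hτ : τ ∈ Ioo (π / 3) (2 * π / 3)) :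
    ∫⁻ θ in Ioo 0 τ, ENNReal.ofReal (2 * ellipticKPrime (a * (cos θ - cos τ)))
      = ENNReal.ofReal (2 * levelIntegral a τ) := by
  have hτ0 : 0 < τ := by linarith [hτ.1, div_pos pi_pos three_pos]
  have hm := measurable_ellipticKPrime
  have h1 : IntervalIntegrable (fun u => ellipticKPrime (a * (cos (τ * u) - cos τ)))
      volume 0 1 := by
    refine (intervalIntegrable_levelBound a).mono_fun'
      (Measurable.aestronglyMeasurable (by fun_prop)) ?_
    refine (ae_restrict_iff' measurableSet_uIoc).2 ?_
    filter_upwards [ae_mem_Ioo_of_mem_uIoc] with u hu hu'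
    exact ellipticKPrime_levelIntegrand_le ha hτ (hu hu')
  have h2 : IntervalIntegrable (fun θ => ellipticKPrime (a * (cos θ - cos τ))) volume 0 τ := by
    have h := h1.comp_mul_left (c := τ⁻¹)
    simpa [mul_inv_cancel_left₀ hτ0.ne'] using h
  rw [levelIntegral, ← intervalIntegral.integral_const_mul,
    intervalIntegral.integral_of_le hτ0.le, integral_Ioc_eq_integral_Ioo,
    ofReal_integral_eq_lintegral_ofReal]
  · exact (h2.const_mul 2).1.mono_set Ioo_subset_Ioc_self
  · exact ae_of_all _ fun θ => mul_nonneg zero_le_two (ellipticKPrime_nonneg _)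

lemma arccos_mem_Ioo {x : ℝ} (hx : x ∈ Ioo (-(1 / 2) : ℝ) (1 / 2)) :
    arccos x ∈ Ioo (π / 3) (2 * π / 3) := by
  have h1 : arccos (1 / 2) = π / 3 := by
    rw [← cos_pi_div_three]
    exact arccos_cos (by positivity) (by linarith [pi_pos])
  have h2 : arccos (-(1 / 2)) = 2 * π / 3 := by rw [arccos_neg, h1]; ring
  rw [← h1, ← h2]
  exact ⟨arccos_lt_arccos (by linarith [hx.1]) hx.2 (by norm_num),
    arccos_lt_arccos (by norm_num) hx.1 (by linarith [hx.2])⟩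

lemma pi_sub_mem_Ioo {τ : ℝ} (hτ : τ ∈ Ioo (π / 3) (2 * π / 3)) :
    π - τ ∈ Ioo (π / 3) (2 * π / 3) :=
  ⟨by linarith [hτ.2], by linarith [hτ.1]⟩

/-- The density, with respect to Lebesgue measure, of the band energy on the Brillouin zone, for
energies near `0`. -/
noncomputable def bandDensity (tz E : ℝ) : ℝ :=
  4 * (levelIntegral (tz / 2) (arccos (-E / (2 * tz)))
    + levelIntegral (tz / 2) (π - arccos (-E / (2 * tz))))

lemma neg_div_mem_Ioo {tz E : ℝ} (ht : 0 < tz) (hE : E ∈ Ioo (-tz) tz) :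
    -E / (2 * tz) ∈ Ioo (-(1 / 2) : ℝ) (1 / 2) := by
  constructor
  · rw [lt_div_iff₀ (by positivity)]; linarith [hE.2]
  · rw [div_lt_iff₀ (by positivity)]; linarith [hE.1]

lemma continuousAt_bandDensity {tz E : ℝ} (ht : tz ∈ Ioo (0 : ℝ) (1 / 2))
    (hE : E ∈ Ioo (-tz) tz) : ContinuousAt (bandDensity tz) E := by
  have ha : tz / 2 ∈ Ioo (0 : ℝ) (1 / 4) := ⟨by linarith [ht.1], by linarith [ht.2]⟩
  have hτ := arccos_mem_Ioo (neg_div_mem_Ioo ht.1 hE)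
  have hc : ContinuousAt (fun E => arccos (-E / (2 * tz))) E := by fun_prop
  unfold bandDensity
  refine continuousAt_const.mul (ContinuousAt.add ?_ ?_)
  · exact ContinuousAt.comp (f := fun E => arccos (-E / (2 * tz)))
      (continuousAt_levelIntegral ha hτ) hc
  · exact ContinuousAt.comp (f := fun E => π - arccos (-E / (2 * tz)))
      (continuousAt_levelIntegral ha (pi_sub_mem_Ioo hτ)) (continuousAt_const.sub hc)

lemma bandDensity_nonneg (tz E : ℝ) : 0 ≤ bandDensity tz E := by
  have h1 := levelIntegral_nonneg (a := tz / 2) (arccos_nonneg (-E / (2 * tz)))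
  have h2 := levelIntegral_nonneg (a := tz / 2)
    (sub_nonneg.2 (arccos_le_pi (-E / (2 * tz))))
  unfold bandDensity
  positivity

/-- Writing `E = -2 tz cos τ`, the argument of the planar weight is `2 tz (cos θ - cos τ)`, which on
`[0, π]` vanishes only at `θ = τ`. The interval is split there; the reflection `θ ↦ π - θ` and the
evenness of `ellipticKPrime` give the second level integral the form of the first. -/
lemma bandWeight_eq {tz E : ℝ} (ht : tz ∈ Ioo (0 : ℝ) (1 / 2)) (hE : E ∈ Ioo (-tz) tz) :
    bandWeight tz E = ENNReal.ofReal (bandDensity tz E) := by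
  have ht0 := ht.1
  have ha : tz / 2 ∈ Ioo (0 : ℝ) (1 / 4) := ⟨by linarith [ht.1], by linarith [ht.2]⟩
  have hx := neg_div_mem_Ioo ht.1 hE
  have hτ := arccos_mem_Ioo hx
  rw [bandDensity]
  set τ := arccos (-E / (2 * tz)) with hτd
  have hcos : E = -(2 * tz * cos τ) := by
    rw [hτd, cos_arccos (by linarith [hx.1]) (by linarith [hx.2])]
    field_simp
  have hτ' := pi_sub_mem_Ioo hτ
  have hτ0 : 0 < τ := by linarith [hτ.1, div_pos pi_pos three_pos]
  have hτπ : τ < π := by linarith [hτ'.1, div_pos pi_pos three_pos]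
  have hW : ∀ θ ∈ Icc 0 π, θ ≠ τ → planarWeight (E + 2 * tz * cos θ)
      = ENNReal.ofReal (2 * ellipticKPrime (tz / 2 * (cos θ - cos τ))) := fun θ hθ hne => by
    have e : E + 2 * tz * cos θ = 2 * tz * (cos θ - cos τ) := by rw [hcos]; ring
    have hne' : cos θ - cos τ ≠ 0 :=
      sub_ne_zero.2 fun h => hne (injOn_cos hθ ⟨hτ0.le, hτπ.le⟩ h)
    rw [e, planarWeight_eq]
    · congr 3
      ring
    · positivity
    · rw [← e, abs_lt]
      constructor <;>
        nlinarith [cos_le_one θ, neg_one_le_cos θ, hE.1, hE.2, ht.2]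
  have h1 : ∫⁻ θ in Ioo 0 τ, planarWeight (E + 2 * tz * cos θ)
      = ENNReal.ofReal (2 * levelIntegral (tz / 2) τ) := by
    rw [← setLIntegral_levelIntegrand ha hτ]
    exact setLIntegral_congr_fun measurableSet_Ioo fun θ hθ =>
      hW θ ⟨hθ.1.le, (hθ.2.trans hτπ).le⟩ hθ.2.ne
  have h2 : ∫⁻ θ in Ioo τ π, planarWeight (E + 2 * tz * cos θ)
      = ENNReal.ofReal (2 * levelIntegral (tz / 2) (π - τ)) := by
    rw [← setLIntegral_levelIntegrand ha hτ', ← lintegral_indicator measurableSet_Ioo,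
      ← lintegral_indicator measurableSet_Ioo, ← lintegral_sub_left_eq_self _ π]
    refine lintegral_congr fun θ => ?_
    by_cases hθ : θ ∈ Ioo 0 (π - τ)
    · have hθ' : π - θ ∈ Ioo τ π := ⟨by linarith [hθ.2], by linarith [hθ.1]⟩
      rw [indicator_of_mem hθ, indicator_of_mem hθ',
        hW _ ⟨by linarith [hθ'.1], hθ'.2.le⟩ hθ'.1.ne', cos_pi_sub, cos_pi_sub,
        ← ellipticKPrime_neg]
      congr 3
      ring
    · have hθ' : π - θ ∉ Ioo τ π := fun h => hθ ⟨by linarith [h.2], by linarith [h.1]⟩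
      rw [indicator_of_notMem hθ, indicator_of_notMem hθ']
  have hsplit : ∫⁻ θ in Ioo 0 π, planarWeight (E + 2 * tz * cos θ)
      = (∫⁻ θ in Ioo 0 τ, planarWeight (E + 2 * tz * cos θ))
        + ∫⁻ θ in Ioo τ π, planarWeight (E + 2 * tz * cos θ) := by
    rw [setLIntegral_congr (Ioo_ae_eq_Ioc (a := 0) (b := π)),
      setLIntegral_congr (Ioo_ae_eq_Ioc (a := 0) (b := τ)),
      setLIntegral_congr (Ioo_ae_eq_Ioc (a := τ) (b := π)),
      ← Ioc_union_Ioc_eq_Ioc hτ0.le hτπ.le,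
      lintegral_union measurableSet_Ioc (Ioc_disjoint_Ioc_of_le le_rfl)]
  have hn1 := levelIntegral_nonneg (a := tz / 2) hτ0.le
  have hn2 := levelIntegral_nonneg (a := tz / 2) (sub_nonneg.2 hτπ.le)
  rw [bandWeight, setLIntegral_Ioc_of_even (fun θ => by rw [cos_neg]), hsplit, h1, h2,
    ← ENNReal.ofReal_add (by positivity) (by positivity),
    show (2 : ℝ≥0∞) = ENNReal.ofReal 2 by simp, ← ENNReal.ofReal_mul zero_le_two]
  congr 1
  ring

/-! ### Differentiating the integrated density of states near zero energy -/

lemma integratedDensityOfStates_eq {tz : ℝ} (ht : tz ∈ Ioo (0 : ℝ) (1 / 2)) {E : ℝ}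
    (hE : E ∈ Ioo (-(tz / 2)) (tz / 2)) :
    integratedDensityOfStates tz E = integratedDensityOfStates tz (-(tz / 2))
      + (∫ y in (-(tz / 2))..E, bandDensity tz y) / (2 * π) ^ 3 := by
  have ht0 := ht.1
  have hfin : ∀ E, ∫⁻ y in Iic E, bandWeight tz y ≠ ⊤ := fun E => by
    rw [← volume_sublevel_eq]
    refine ne_top_of_le_ne_top ?_ (measure_mono (t := brillouinZone) (sep_subset _ _))
    exact (isCompact_Icc.prod (isCompact_Icc.prod isCompact_Icc)).measure_lt_top.ne
  have hsub : Icc (-(tz / 2)) E ⊆ Ioo (-tz) tz := fun y hy =>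
    ⟨by linarith [hy.1], by linarith [hy.2, hE.2]⟩
  have hcont : ContinuousOn (bandDensity tz) (Icc (-(tz / 2)) E) := fun y hy =>
    (continuousAt_bandDensity ht (hsub hy)).continuousWithinAt
  have h1 : ∫⁻ y in Ioc (-(tz / 2)) E, bandWeight tz y
      = ENNReal.ofReal (∫ y in (-(tz / 2))..E, bandDensity tz y) := by
    rw [intervalIntegral.integral_of_le hE.1.le, ofReal_integral_eq_lintegral_ofReal
      (hcont.integrableOn_Icc.mono_set Ioc_subset_Icc_self)
      (ae_of_all _ fun y => bandDensity_nonneg tz y)]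
    exact setLIntegral_congr_fun measurableSet_Ioc fun y hy =>
      bandWeight_eq ht (hsub (Ioc_subset_Icc_self hy))
  have h2 : ∫⁻ y in Iic E, bandWeight tz y = (∫⁻ y in Iic (-(tz / 2)), bandWeight tz y)
      + ENNReal.ofReal (∫ y in (-(tz / 2))..E, bandDensity tz y) := by
    rw [← h1, ← Iic_union_Ioc_eq_Iic hE.1.le,
      lintegral_union measurableSet_Ioc (Iic_disjoint_Ioc le_rfl)]
  have h3 : 0 ≤ ∫ y in (-(tz / 2))..E, bandDensity tz y :=
    intervalIntegral.integral_nonneg hE.1.le fun y _ => bandDensity_nonneg tz y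
  rw [integratedDensityOfStates, integratedDensityOfStates, volume_sublevel_eq,
    volume_sublevel_eq, h2, ENNReal.toReal_add (hfin _) ENNReal.ofReal_ne_top,
    ENNReal.toReal_ofReal h3, add_div]

lemma hasDerivAt_integratedDensityOfStates {tz : ℝ} (ht : tz ∈ Ioo (0 : ℝ) (1 / 2)) {E : ℝ}
    (hE : E ∈ Ioo (-(tz / 2)) (tz / 2)) :
    HasDerivAt (integratedDensityOfStates tz) (bandDensity tz E / (2 * π) ^ 3) E := by
  have ht0 := ht.1
  have hsub : Icc (-(tz / 2)) (tz / 2) ⊆ Ioo (-tz) tz := fun y hy =>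
    ⟨by linarith [hy.1], by linarith [hy.2, hE.2]⟩
  have hcont : ContinuousOn (bandDensity tz) (Icc (-(tz / 2)) (tz / 2)) := fun y hy =>
    (continuousAt_bandDensity ht (hsub hy)).continuousWithinAt
  have hint : IntervalIntegrable (bandDensity tz) volume (-(tz / 2)) E := by
    refine ContinuousOn.intervalIntegrable (hcont.mono ?_)
    rw [uIcc_of_le hE.1.le]
    exact Icc_subset_Icc_right hE.2.le
  have hmeas : StronglyMeasurableAtFilter (bandDensity tz) (𝓝 E) volume :=
    (hcont.mono Ioo_subset_Icc_self).stronglyMeasurableAtFilter isOpen_Ioo E hE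
  have h := ((intervalIntegral.integral_hasDerivAt_right hint hmeas
    (continuousAt_bandDensity ht (hsub (Ioo_subset_Icc_self hE)))).div_const
      ((2 * π) ^ 3)).const_add (integratedDensityOfStates tz (-(tz / 2)))
  refine h.congr_of_eventuallyEq ?_
  filter_upwards [Ioo_mem_nhds hE.1 hE.2] with y hy using integratedDensityOfStates_eq ht hy

lemma contDiffAt_integratedDensityOfStates {tz : ℝ} (ht : tz ∈ Ioo (0 : ℝ) (1 / 2)) :
    ContDiffAt ℝ 1 (integratedDensityOfStates tz) 0 := by
  have ht0 := ht.1
  have hmem : Ioo (-(tz / 2)) (tz / 2) ∈ 𝓝 (0 : ℝ) := Ioo_mem_nhds (by linarith) (by linarith)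
  suffices h : ContDiffOn ℝ (0 + 1) (integratedDensityOfStates tz) (Ioo (-(tz / 2)) (tz / 2)) by
    simpa using h.contDiffAt hmem
  rw [contDiffOn_succ_iff_deriv_of_isOpen isOpen_Ioo]
  refine ⟨fun E hE =>
    (hasDerivAt_integratedDensityOfStates ht hE).differentiableAt.differentiableWithinAt,
    by simp, contDiffOn_zero.2 ?_⟩
  refine ContinuousOn.congr (f := fun E => bandDensity tz E / (2 * π) ^ 3) (fun E hE => ?_)
    fun E hE => (hasDerivAt_integratedDensityOfStates ht hE).deriv
  exact ((continuousAt_bandDensity ht ⟨by linarith [hE.1], by linarith [hE.2]⟩).div_const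
    _).continuousWithinAt

/-- At `E = 0` the level is `τ = π / 2`, both level integrals coincide, and `8 / (2 π)³ = 1 / π³`.
-/
lemma densityOfStates_zero_eq {tz : ℝ} (ht : tz ∈ Ioo (0 : ℝ) (1 / 2)) :
    densityOfStates tz 0
      = 1 / π ^ 3 * ∫ θ in (0 : ℝ)..(π / 2), ellipticKPrime (tz / 2 * cos θ) := by
  have ht0 := ht.1
  rw [densityOfStates,
    (hasDerivAt_integratedDensityOfStates ht ⟨by linarith, by linarith⟩).deriv, bandDensity]
  simp only [neg_zero, zero_div, arccos_zero, sub_half, levelIntegral, cos_pi_div_two, sub_zero]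
  field_simp
  ring

/-! ### The asymptotic expansion and its derivatives -/

theorem mainTheorem8 :
    -- for small `t_z > 0` the density of states is a well-defined continuous function of the
    -- energy near energy `0`, and `t_z ↦ N_{t_z}(0)` is smooth
    (∃ δ : ℝ, 0 < δ ∧
      (∀ tz ∈ Ioo 0 δ, ContDiffAt ℝ 1 (integratedDensityOfStates tz) 0) ∧
      ContDiffOn ℝ ∞ (fun tz : ℝ => densityOfStates tz 0) (Ioo 0 δ)) ∧
    -- the expansion
    ((fun tz : ℝ => densityOfStates tz 0 - densityExpansion tz)
      =O[𝓝[>] 0] fun tz : ℝ => tz ^ 12 * log (1 / tz)) ∧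
    -- termwise differentiation, any finite number of times, error term included
    (∀ n : ℕ,
      (fun tz : ℝ => iteratedDeriv n (fun s : ℝ => densityOfStates s 0) tz
          - iteratedDeriv n densityExpansion tz)
        =O[𝓝[>] 0] iteratedDeriv n (fun s : ℝ => s ^ 12 * log (1 / s))) := by
  have hsub : Ioo (0 : ℝ) (1 / 2) ⊆ Ioo (-1) 1 := Ioo_subset_Ioo (by norm_num) (by norm_num)
  have hsmooth : ContDiffOn ℝ ∞ (fun tz : ℝ => densityOfStates tz 0) (Ioo 0 (1 / 2)) := by
    have hlog : ContDiffOn ℝ ∞ (fun t : ℝ => log (1 / t)) (Ioo 0 (1 / 2)) := fun t ht => by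
      simp only [one_div, log_inv]
      exact (contDiffAt_log.2 ht.1.ne').neg.contDiffWithinAt
    refine ((((contDiffOn_evenSeries abs_logCoeff_le).mono hsub).mul hlog).add
      ((contDiffOn_evenSeries abs_regCoeff_le).mono hsub)).congr fun t ht => ?_
    rw [densityOfStates_zero_eq ht, densityIntegral_eq ⟨ht.1, by linarith [ht.2]⟩]
  have hdiff : ∀ t ∈ Ioo (0 : ℝ) (1 / 2), densityOfStates t 0 - densityExpansion t
      = evenSeries (fun n => logCoeff (n + 6)) t * (t ^ 12 * log (1 / t))
        + evenSeries (fun n => regCoeff (n + 6)) t * t ^ 12 := fun t ht => by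
    rw [densityOfStates_zero_eq ht,
      densityIntegral_sub_densityExpansion ⟨ht.1, by linarith [ht.2]⟩]
  have hderiv : ∀ n : ℕ,
      (fun tz : ℝ => iteratedDeriv n (fun s : ℝ => densityOfStates s 0) tz
          - iteratedDeriv n densityExpansion tz)
        =O[𝓝[>] 0] iteratedDeriv n (fun s : ℝ => s ^ 12 * log (1 / s)) := fun n => by
    refine (iteratedDeriv_isBigO_of_eq_log_expansion
      (contDiffOn_evenSeries fun n => abs_logCoeff_le (n + 6))
      (contDiffOn_evenSeries fun n => abs_regCoeff_le (n + 6)) 12 n).congr' ?_ EventuallyEq.rfl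
    filter_upwards [Ioo_mem_nhdsGT (one_half_pos (α := ℝ))] with t ht
    have hnhds := Ioo_mem_nhds ht.1 ht.2
    have h1 : ContDiffAt ℝ n (fun s : ℝ => densityOfStates s 0) t :=
      (hsmooth.contDiffAt hnhds).of_le (by exact_mod_cast le_top)
    have h2 : ContDiffAt ℝ n densityExpansion t := by
      have hlog : ContDiffAt ℝ n (fun s : ℝ => log (16 / s)) t :=
        (contDiffAt_const.div contDiffAt_id ht.1.ne').log (div_pos (by norm_num) ht.1).ne'
      unfold densityExpansion
      fun_prop
    rw [← iteratedDeriv_fun_sub h1 h2]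
    -- The exact remainder formula holds on a whole neighbourhood of `t`, so all its derivatives at
    -- `t` agree as well.
    refine Filter.EventuallyEq.iteratedDeriv_eq n ?_
    filter_upwards [hnhds] with s hs using (hdiff s hs).symm
  exact ⟨⟨1 / 2, one_half_pos, fun tz ht => contDiffAt_integratedDensityOfStates ht, hsmooth⟩,
    by simpa only [iteratedDeriv_zero] using hderiv 0, hderiv⟩
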